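/- Consider the feedback loop $e=r-\mathcal C_4y$, $z=\mathcal C_1e$, $z_s=\mathcal C_sz$, $u=\mathcal C_3(m+\mathcal C_2z)$, $y=\mathcal P(u+d)$, where $\mathcal C_1,\mathcal C_2,\mathcal C_3,\mathcal C_4,\mathcal C_s,\mathcal P$ are finite-dimensional SISO LTI systems (with frequency responses $\mathcal C_1(\omega)=\mathcal C_1(s)|_{s=j\omega}$ etc.) and $m$ is the output of the reset controller $\mathcal C_r$: $$\dot x_r=A_Rx_r+B_Rz\ (t\notin J),\qquad x_r(t^+)=A_\rho x_r(t)\ (t\in J),\qquad m=C_Rx_r+D_Rz,$$ $A_\rho=\mathrm{diag}(\gamma,1,\dots,1)$, $\gamma\in(-1,1]$, with base-linear controller $\mathcal C_l(\omega)=C_R(j\omega I-A_R)^{-1}B_R+D_R$. Let $r=0$ and $d(t)=|D|\sin\omega t$ with $|D|,\omega>0$. Write the $n$th harmonic of a $2\pi/\omega$-periodic signal $f$ as $|F^n|\sin(n\omega t+\angle F^n)$ and put $F^n=|F^n|e^{j\angle F^n}$. Consider a two-reset steady-state response of the loop: a $2\pi/\omega$-periodic response, defined for all times, whose resets are triggered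 by the first harmonic $z_s^1(t)=|Z_s^1|\sin(\omega t+\angle Z_s^1)\neq0$ of $z_s$, i.e. $J=\{t: z_s^1(t)=0\}$. Assume that the loop is convergent: any two responses to this $d$ with reset instants $J$ approach each other as $t\to\infty$. Let $$\Delta_l(\omega)=(j\omega I-A_R)^{-1}B_R,\quad \Delta_x(\omega)=C_R(j\omega I-A_R)^{-1}j\omega,\quad \Delta_c(\omega)=|\Delta_l(\omega)|\sin(\angle\Delta_l(\omega)-\angle\mathcal C_s(\omega))\ \text{(entrywise)},$$ $$\Delta_q(\omega)=(I+e^{A_R\pi/\omega})(A_\rho e^{A_R\pi/\omega}+I)^{-1}(A_\rho-I)\Delta_c(\omega),\quad \mathcal C_\rho^n(\omega)=\frac{2}{n\pi}\Delta_x(n\omega)\Delta_q(\omega)e^{jn\angle\mathcal C_s(\omega)},$$ $$\mathcal L_1(\omega)=\mathcal C_1(\omega)[\mathcal C_l(\omega)+\mathcal C_\rho^1(\omega)+\mathcal C_2(\omega)]\mathcal C_3(\omega)\mathcal P(\omega),\quad \mathcal L_n(\omega)=\mathcal C_1(\omega)e^{j(n-1)\angle\mathcal C_1(\omega)}\mathcal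 C_\rho^n(\omega)\mathcal C_3(n\omega)\mathcal P(n\omega)\ (n>1\text{ odd}),$$ $$\mathcal L_l(\omega)=[\mathcal C_l(\omega)+\mathcal C_2(\omega)]\mathcal C_3(\omega)\mathcal P(\omega)\mathcal C_4(\omega)\mathcal C_1(\omega),\quad \mathcal S_l(\omega)=\frac1{1+\mathcal L_l(\omega)},$$ $$\mathcal L_\rho(n\omega)=\mathcal C_\rho^n(\omega)\mathcal C_3(n\omega)\mathcal P(n\omega)\mathcal C_4(n\omega)\mathcal C_1(n\omega),\quad \Psi_n(\omega)=\frac{|\mathcal L_\rho(n\omega)|}{|1+\mathcal L_l(n\omega)|}.$$ With $\Delta_{l,1}$ the entry of $\Delta_l$ for the reset state, let $\Delta_c^1(\omega)=|\Delta_{l,1}(\omega)|\sin(\angle\Delta_{l,1}(\omega)-\angle\mathcal C_s(\omega))$ and, for $n>1$, $\Delta_c^n(\omega)=-|\Delta_{l,1}(n\omega)|\sin(\angle\Delta_{l,1}(n\omega)+\angle\mathcal L_\rho(n\omega)-\angle(1+\mathcal L_l(n\omega))-n\angle\mathcal C_s(\omega))$, and $$\Gamma(\omega)=\Bigl(1-\sum_{n=3,5,7,\dots}\Psi_n(\omega)\Delta_c^n(\omega)/\Delta_c^1(\omega)\Bigr)^{-1},\qquad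 \mathcal L_o(\omega)=\mathcal L_1(\omega)\mathcal C_4(\omega)+(\Gamma(\omega)-1)\mathcal L_\rho(\omega).$$ Assume that these expressions make sense: no block has a pole at an odd multiple of $j\omega$, the algebraic loop is well posed ($1+\mathcal L_l(\infty)\ne0$), $A_\rho e^{A_R\pi/\omega}+I$ is invertible, and $\Delta_c^1(\omega)\neq0$. Then $1+\mathcal L_l(n\omega)\ne0$ for odd $n>1$, the series in $\Gamma(\omega)$ converges absolutely, its denominator and $1+\mathcal L_o(\omega)$ are non-zero, and the higher-order process sensitivity functions $\mathcal{PS}_n(\omega)=E^n(\omega)/D^n(\omega)$, where $D^n(\omega)$ belongs to $d^n(t)=|D|\sin n\omega t$, are $$\mathcal{PS}_n(\omega)=\begin{cases}-\mathcal P(\omega)\mathcal C_4(\omega)/(1+\mathcal L_o(\omega)),&n=1,\\-\mathcal S_l(n\omega)\,|\mathcal{PS}_1(\omega)|e^{jn\angle\mathcal{PS}_1(\omega)}\,\Gamma(\omega)\mathcal L_n(\omega)\mathcal C_4(n\omega),&n>1\text{ odd},\\0,&n\geqslant2\text{ even}.\end{cases}$$ -/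

import Mathlib

open Complex Filter Topology Matrix Set

noncomputable section

/-- The `n`-th harmonic of a `2π/ω`-periodic signal `f`, as the complex number `|F| exp (j ∠F)` for
which the `n`-th Fourier component of `f` is `|F| sin (n ω t + ∠F)`. -/
def harmonicCoeff (ω : ℝ) (n : ℕ) (f : ℝ → ℝ) : ℂ :=
  I * ((ω / Real.pi : ℝ) : ℂ) *
    ∫ t in (0 : ℝ)..(2 * Real.pi / ω), (f t : ℂ) * exp (-(I * n * ω * t))

/-- The `n`-th harmonic component of `f`, as a function of time. -/
def harmonicSignal (ω : ℝ) (n : ℕ) (f : ℝ → ℝ) (t : ℝ) : ℝ :=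
  ‖harmonicCoeff ω n f‖ * Real.sin (n * ω * t + arg (harmonicCoeff ω n f))

/-- `j ω I - A` -/
def pencil {n : ℕ} (A : Matrix (Fin n) (Fin n) ℝ) (ω : ℝ) : Matrix (Fin n) (Fin n) ℂ :=
  (I * ω) • (1 : Matrix (Fin n) (Fin n) ℂ) - A.map ofReal

/-- A finite-dimensional single-input single-output LTI system in state-space form. -/
structure LTI where
  dim : ℕ
  A : Matrix (Fin dim) (Fin dim) ℝ
  B : Fin dim → ℝ
  C : Fin dim → ℝ
  D : ℝ

namespace LTI

/-- The frequency response `C (j ω I - A)⁻¹ B + D`. -/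
def freq (G : LTI) (ω : ℝ) : ℂ :=
  (fun i => (G.C i : ℂ)) ⬝ᵥ ((pencil G.A ω)⁻¹ *ᵥ fun i => (G.B i : ℂ)) + G.D

/-- On the (open) time set `T`, the input `u` drives the state `x` and gives the output `y`. The
input may jump at the isolated instants `J`, where the state is only required to be continuous. -/
def Responds (G : LTI) (T J : Set ℝ) (u : ℝ → ℝ) (x : ℝ → Fin G.dim → ℝ) (y : ℝ → ℝ) : Prop :=
  ContinuousOn x T ∧
  (∀ t ∈ T \ J, HasDerivAt x (G.A *ᵥ x t + u t • G.B) t) ∧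
  ∀ t ∈ T, y t = G.C ⬝ᵥ x t + G.D * u t

end LTI

/-- A reset controller with `k + 1` states, of which the first one is reset, with reset value
`γ ∈ (-1, 1]`. -/
structure ResetController where
  k : ℕ
  A : Matrix (Fin (k + 1)) (Fin (k + 1)) ℝ
  B : Fin (k + 1) → ℝ
  C : Fin (k + 1) → ℝ
  D : ℝ
  γ : ℝ
  γ_mem : γ ∈ Ioc (-1 : ℝ) 1

namespace ResetController

/-- The base-linear controller. -/
def base (R : ResetController) : LTI := ⟨R.k + 1, R.A, R.B, R.C, R.D⟩

/-- The reset matrix `diag (γ, 1, …, 1)`. -/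
def Aρ (R : ResetController) : Matrix (Fin (R.k + 1)) (Fin (R.k + 1)) ℝ :=
  Matrix.diagonal (Fin.cons R.γ fun _ => 1)

/-- On the (open) time set `T`, with reset instants `J`, the input `z` drives the state `x` and
gives the output `m`. The state is left-continuous: at a reset instant `x t` is the value before
the reset. -/
def Responds (R : ResetController) (T J : Set ℝ) (z : ℝ → ℝ) (x : ℝ → Fin (R.k + 1) → ℝ)
    (m : ℝ → ℝ) : Prop :=
  (∀ t ∈ T \ J, HasDerivAt x (R.A *ᵥ x t + z t • R.B) t) ∧
  (∀ t ∈ T ∩ J, Tendsto x (𝓝[<] t) (𝓝 (x t)) ∧ Tendsto x (𝓝[>] t) (𝓝 (R.Aρ *ᵥ x t))) ∧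
  ∀ t ∈ T, m t = R.C ⬝ᵥ x t + R.D * z t

/-- `exp (A_R π / ω)` -/
def expHalf (R : ResetController) (ω : ℝ) : Matrix (Fin (R.k + 1)) (Fin (R.k + 1)) ℝ :=
  NormedSpace.exp ((Real.pi / ω) • R.A)

/-- `Δ_l(ω) = (j ω I - A_R)⁻¹ B_R` -/
def Δl (R : ResetController) (ω : ℝ) : Fin (R.k + 1) → ℂ :=
  (pencil R.A ω)⁻¹ *ᵥ fun i => (R.B i : ℂ)

/-- The row vector `Δ_x(ω) = C_R (j ω I - A_R)⁻¹ j ω`. -/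
def Δx (R : ResetController) (ω : ℝ) : Fin (R.k + 1) → ℂ :=
  (I * ω) • ((fun i => (R.C i : ℂ)) ᵥ* (pencil R.A ω)⁻¹)

end ResetController

/-- The blocks of the generalized reset feedback loop. -/
structure ResetLoop where
  Cr : ResetController
  C1 : LTI
  C2 : LTI
  C3 : LTI
  C4 : LTI
  Cs : LTI
  P : LTI

namespace ResetLoop

/-- The block states and the signals of the loop, as functions of time. -/
structure Trajectory (S : ResetLoop) where
  xr : ℝ → Fin (S.Cr.k + 1) → ℝ
  x1 : ℝ → Fin S.C1.dim → ℝ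
  x2 : ℝ → Fin S.C2.dim → ℝ
  x3 : ℝ → Fin S.C3.dim → ℝ
  x4 : ℝ → Fin S.C4.dim → ℝ
  xs : ℝ → Fin S.Cs.dim → ℝ
  xP : ℝ → Fin S.P.dim → ℝ
  /-- error -/
  e : ℝ → ℝ
  /-- input of the reset controller -/
  z : ℝ → ℝ
  /-- output of the shaping filter -/
  zs : ℝ → ℝ
  /-- output of the reset controller -/
  m : ℝ → ℝ
  /-- output of the branch parallel to the reset controller -/
  a : ℝ → ℝ
  /-- control input -/
  u : ℝ → ℝ
  /-- system output -/
  y : ℝ → ℝ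
  /-- fed-back output -/
  f : ℝ → ℝ

/-- The state of the whole closed loop. -/
def Trajectory.state {S : ResetLoop} (X : S.Trajectory) (t : ℝ) :
    (Fin (S.Cr.k + 1) → ℝ) × (Fin S.C1.dim → ℝ) × (Fin S.C2.dim → ℝ) × (Fin S.C3.dim → ℝ) ×
      (Fin S.C4.dim → ℝ) × (Fin S.Cs.dim → ℝ) × (Fin S.P.dim → ℝ) :=
  (X.xr t, X.x1 t, X.x2 t, X.x3 t, X.x4 t, X.xs t, X.xP t)

/-- `X` satisfies the loop equations on the time set `T` with reference `r`, disturbance `d` (added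
at the plant input) and reset instants `J`:
`z = C₁ e`, `z_s = C_s z`, `m = C_r z`, `a = C₂ z`, `u = C₃ (m + a)`, `y = P (u + d)`,
`e = r - C₄ y`. -/
structure IsResponse (S : ResetLoop) (T J : Set ℝ) (r d : ℝ → ℝ) (X : S.Trajectory) : Prop where
  c1 : S.C1.Responds T J X.e X.x1 X.z
  cs : S.Cs.Responds T J X.z X.xs X.zs
  cr : S.Cr.Responds T J X.z X.xr X.m
  c2 : S.C2.Responds T J X.z X.x2 X.a
  c3 : S.C3.Responds T J (fun t => X.m t + X.a t) X.x3 X.u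
  p : S.P.Responds T J (fun t => X.u t + d t) X.xP X.y
  c4 : S.C4.Responds T J X.y X.x4 X.f
  err : ∀ t ∈ T, X.e t = r t - X.f t

/-- Convergence: any two responses of the loop to the same inputs approach each other. -/
def IsConvergent (S : ResetLoop) (J : Set ℝ) (r d : ℝ → ℝ) : Prop :=
  ∀ X Y : S.Trajectory, S.IsResponse (Ioi 0) J r d X → S.IsResponse (Ioi 0) J r d Y →
    Tendsto (fun t => X.state t - Y.state t) atTop (𝓝 0)

/-- The zero-crossing instants of the first harmonic `z_s¹` of the output of the shaping filter. -/
def resetInstants {S : ResetLoop} (ω : ℝ) (X : S.Trajectory) : Set ℝ :=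
  {t | harmonicSignal ω 1 X.zs t = 0}

/-- A steady-state response of the two-reset closed loop to inputs of frequency `ω`: a
`2π/ω`-periodic response defined for all times, whose resets are triggered by the (non-zero) first
harmonic `z_s¹`. -/
structure IsTwoResetSteadyState (S : ResetLoop) (ω : ℝ) (r d : ℝ → ℝ) (X : S.Trajectory) :
    Prop where
  response : S.IsResponse univ (resetInstants ω X) r d X
  periodic : Function.Periodic X.state (2 * Real.pi / ω)
  trigger_ne_zero : harmonicCoeff ω 1 X.zs ≠ 0

/-- The algebraic loop of the base-linear system is well posed. -/
def WellPosed (S : ResetLoop) : Prop :=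
  1 + (S.Cr.D + S.C2.D) * S.C3.D * S.P.D * S.C4.D * S.C1.D ≠ 0

/-- No block has a pole at an odd multiple of `j ω`. -/
def FreqDefined (S : ResetLoop) (ω : ℝ) : Prop :=
  ∀ n : ℕ, Odd n → ∀ G ∈ [S.Cr.base, S.C1, S.C2, S.C3, S.C4, S.Cs, S.P],
    (pencil G.A (n * ω)).det ≠ 0

/-- The vector of the `|Δ_l(ω)| sin (∠Δ_l(ω) - ∠C_s(ω))`, entry by entry. -/
def Δc (S : ResetLoop) (ω : ℝ) : Fin (S.Cr.k + 1) → ℝ := fun i =>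
  ‖S.Cr.Δl ω i‖ * Real.sin (arg (S.Cr.Δl ω i) - arg (S.Cs.freq ω))

/-- `Δ_q(ω) = (I + e^{A_R π/ω}) (A_ρ e^{A_R π/ω} + I)⁻¹ (A_ρ - I) Δ_c(ω)` -/
def Δq (S : ResetLoop) (ω : ℝ) : Fin (S.Cr.k + 1) → ℝ :=
  ((1 + S.Cr.expHalf ω) * (S.Cr.Aρ * S.Cr.expHalf ω + 1)⁻¹ * (S.Cr.Aρ - 1)) *ᵥ S.Δc ω

/-- `C_ρⁿ(ω) = 2 Δ_x(nω) Δ_q(ω) e^{j n ∠C_s(ω)} / (n π)` -/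
def Cρ (S : ResetLoop) (ω : ℝ) (n : ℕ) : ℂ :=
  2 * (S.Cr.Δx (n * ω) ⬝ᵥ fun i => (S.Δq ω i : ℂ)) * exp (I * n * arg (S.Cs.freq ω)) /
    (n * Real.pi)

/-- The open-loop higher-order describing functions `L_n(ω)`. -/
def L (S : ResetLoop) (ω : ℝ) (n : ℕ) : ℂ :=
  if n = 1 then
    S.C1.freq ω * (S.Cr.base.freq ω + S.Cρ ω 1 + S.C2.freq ω) * S.C3.freq ω * S.P.freq ω
  else if Odd n then
    S.C1.freq ω * exp (I * (n - 1) * arg (S.C1.freq ω)) * S.Cρ ω n * S.C3.freq (n * ω) *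
      S.P.freq (n * ω)
  else 0

/-- The base-linear loop gain `L_l(ω)`. -/
def Ll (S : ResetLoop) (ω : ℝ) : ℂ :=
  (S.Cr.base.freq ω + S.C2.freq ω) * S.C3.freq ω * S.P.freq ω * S.C4.freq ω * S.C1.freq ω

/-- The base-linear sensitivity function `S_l(ω)`. -/
def Sl (S : ResetLoop) (ω : ℝ) : ℂ := 1 / (1 + S.Ll ω)

/-- `L_ρ(nω)`, which depends on `n` and `ω` separately through `C_ρⁿ(ω)`. -/
def Lρ (S : ResetLoop) (ω : ℝ) (n : ℕ) : ℂ :=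
  S.Cρ ω n * S.C3.freq (n * ω) * S.P.freq (n * ω) * S.C4.freq (n * ω) * S.C1.freq (n * ω)

/-- `Ψ_n(ω)` -/
def Ψ (S : ResetLoop) (ω : ℝ) (n : ℕ) : ℝ := ‖S.Lρ ω n‖ / ‖1 + S.Ll (n * ω)‖

/-- `Δ_cⁿ(ω)`, taken at the state that is reset. -/
def Δcn (S : ResetLoop) (ω : ℝ) (n : ℕ) : ℝ :=
  if n = 1 then S.Δc ω 0
  else -(‖S.Cr.Δl (n * ω) 0‖ * Real.sin (arg (S.Cr.Δl (n * ω) 0) + arg (S.Lρ ω n) -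
    arg (1 + S.Ll (n * ω)) - n * arg (S.Cs.freq ω)))

/-- The terms, for `n = 2 k + 3`, of the series in `Γ(ω)`. -/
def ΓTerm (S : ResetLoop) (ω : ℝ) (k : ℕ) : ℝ := S.Ψ ω (2 * k + 3) * S.Δcn ω (2 * k + 3)

/-- The denominator `1 - ∑_{n = 3, 5, …} Ψ_n(ω) Δ_cⁿ(ω) / Δ_c¹(ω)` of `Γ(ω)`. -/
def ΓDen (S : ResetLoop) (ω : ℝ) : ℝ := 1 - (∑' k, S.ΓTerm ω k) / S.Δcn ω 1

/-- `Γ(ω)` -/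
def Γ (S : ResetLoop) (ω : ℝ) : ℝ := 1 / S.ΓDen ω

/-- `L_o(ω) = L_1(ω) C₄(ω) + (Γ(ω) - 1) L_ρ(ω)`, which is `L_l(ω) + Γ(ω) L_ρ(ω)`. -/
def Lo (S : ResetLoop) (ω : ℝ) : ℂ := S.L ω 1 * S.C4.freq ω + (S.Γ ω - 1) * S.Lρ ω 1

/-- The higher-order process sensitivity function `PS_n(ω) = Eⁿ(ω) / Dⁿ(ω)` of a steady-state
response `X` to the disturbance `D sin (ω t)`, where `Dⁿ` belongs to the virtual harmonic
`D sin (n ω t)`. -/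
def PS {S : ResetLoop} (ω D : ℝ) (X : S.Trajectory) (n : ℕ) : ℂ :=
  harmonicCoeff ω n X.e / harmonicCoeff ω n fun t => D * Real.sin (n * ω * t)

end ResetLoop

end

/-!
Convergence forces half-wave symmetry: the steady state, shifted by half a period and negated, is
again a response with the same inputs and reset instants, so the two coincide. Even harmonics
therefore vanish, and the transform over one half period turns every block into its frequency
response, the reset controller contributing in addition a multiple `g` of `C_ρⁿ(ω)` that comes from
its jump. This gives one balance equation for each odd harmonic. Convergence also makes
`1 + L_l(nω)` non-zero, since otherwise the base-linear loop would oscillate at the frequency `nω`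
with a reset state that can be made to vanish at all reset instants.

To find `g`, subtract from the reset state the free motion caused by its jumps. What remains is the
base-linear steady state driven by `z`; its value at a reset instant is the sum of its Fourier
series and determines the jump. The first harmonic of `z` contributes `Δ_c¹(ω)` to this sum, and the
harmonics of order `n > 1`, themselves proportional to `g`, contribute `g Ψ_n(ω) Δ_cⁿ(ω)`. Solving
for `g` yields `g = Γ(ω)`, and the balance equations become the formulas for `PS_n(ω)`.
-/

noncomputable section

open MeasureTheory Function
open scoped Real

section ContinuousPiece

/-- `f` agrees on `(a, b]` with a continuous function on `[a, b]`. This is how the signals of a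
reset loop behave between two consecutive resets `a` and `b`: they are left-continuous, and at a
reset instant they may jump after it. -/
def IsContinuousPiece {E : Type*} [TopologicalSpace E] (a b : ℝ) (f : ℝ → E) : Prop :=
  ∃ g, ContinuousOn g (Icc a b) ∧ EqOn f g (Ioc a b)

variable {E F : Type*} [TopologicalSpace E] [TopologicalSpace F] {a b : ℝ} {f : ℝ → E}

namespace IsContinuousPiece

theorem of_continuousOn (hf : ContinuousOn f (Icc a b)) : IsContinuousPiece a b f :=
  ⟨f, hf, fun _ _ => rfl⟩

theorem comp {φ : E → F} (hφ : Continuous φ) (hf : IsContinuousPiece a b f) :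
    IsContinuousPiece a b fun t => φ (f t) := by
  obtain ⟨g, hg, hfg⟩ := hf
  exact ⟨fun t => φ (g t), hφ.comp_continuousOn hg, fun t ht => congrArg φ (hfg ht)⟩

theorem prodMk {g : ℝ → F} (hf : IsContinuousPiece a b f) (hg : IsContinuousPiece a b g) :
    IsContinuousPiece a b fun t => (f t, g t) := by
  obtain ⟨f', hf', hff'⟩ := hf
  obtain ⟨g', hg', hgg'⟩ := hg
  exact ⟨_, hf'.prodMk hg', fun t ht => Prod.ext (hff' ht) (hgg' ht)⟩

theorem intervalIntegrable {f : ℝ → ℂ} (hf : IsContinuousPiece a b f) (hab : a ≤ b) :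
    IntervalIntegrable f volume a b := by
  obtain ⟨g, hg, hfg⟩ := hf
  refine (hg.intervalIntegrable_of_Icc hab).congr ?_
  rw [uIoc_of_le hab]
  exact hfg.symm

theorem mul_continuous {f : ℝ → ℝ} {φ : ℝ → ℂ} (hf : IsContinuousPiece a b f) (hφ : Continuous φ) :
    IsContinuousPiece a b fun t => (f t : ℂ) * φ t :=
  (hf.prodMk (of_continuousOn hφ.continuousOn)).comp (φ := fun p : ℝ × ℂ => (p.1 : ℂ) * p.2)
    (by fun_prop)

end IsContinuousPiece

end ContinuousPiece

section HalfCoeff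

/-- The `n`-th harmonic of a signal, computed from its values on the half period
`(a, a + π/ω]` only. It agrees with `harmonicCoeff` for the odd harmonics of an antiperiodic
signal. -/
def halfCoeff (ω a : ℝ) (n : ℕ) (f : ℝ → ℝ) : ℂ :=
  2 * I * ((ω / π : ℝ) : ℂ) * ∫ t in a..a + π / ω, (f t : ℂ) * exp (-(I * n * ω * t))

variable {ω a : ℝ} {n : ℕ} {f g : ℝ → ℝ}

theorem exp_neg_I_mul_add_half_period (hω : 0 < ω) (n : ℕ) (t : ℝ) :
    exp (-(I * n * ω * ((t + π / ω : ℝ) : ℂ))) = (-1) ^ n * exp (-(I * n * ω * t)) := by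
  have hω' : (ω : ℂ) ≠ 0 := by exact_mod_cast hω.ne'
  have harg : -(I * n * ω * ((t + π / ω : ℝ) : ℂ)) = n * (-(π * I)) + -(I * n * ω * t) := by
    push_cast
    field_simp
    ring
  rw [harg, exp_add, exp_nat_mul, exp_neg, exp_pi_mul_I]
  norm_num

theorem IsContinuousPiece.intervalIntegrable_mul_exp (hf : IsContinuousPiece a (a + π / ω) f)
    (hω : 0 < ω) (n : ℕ) :
    IntervalIntegrable (fun t : ℝ => (f t : ℂ) * exp (-(I * n * ω * t))) volume a (a + π / ω) :=
  (hf.mul_continuous (by fun_prop)).intervalIntegrable (le_add_of_nonneg_right (by positivity))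

theorem halfCoeff_congr (hω : 0 < ω) (h : EqOn f g (Ioc a (a + π / ω))) :
    halfCoeff ω a n f = halfCoeff ω a n g := by
  rw [halfCoeff, halfCoeff]
  congr 1
  refine intervalIntegral.integral_congr_ae (Eventually.of_forall fun t ht => ?_)
  rw [uIoc_of_le (le_add_of_nonneg_right (by positivity))] at ht
  rw [h ht]

theorem halfCoeff_add (hω : 0 < ω) (hf : IsContinuousPiece a (a + π / ω) f)
    (hg : IsContinuousPiece a (a + π / ω) g) :
    halfCoeff ω a n (fun t => f t + g t) = halfCoeff ω a n f + halfCoeff ω a n g := by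
  simp only [halfCoeff, ofReal_add, add_mul]
  rw [intervalIntegral.integral_add (hf.intervalIntegrable_mul_exp hω n)
    (hg.intervalIntegrable_mul_exp hω n), mul_add]

theorem halfCoeff_const_mul (c : ℝ) :
    halfCoeff ω a n (fun t => c * f t) = c * halfCoeff ω a n f := by
  simp only [halfCoeff, ofReal_mul, mul_assoc, intervalIntegral.integral_const_mul]
  ring

theorem halfCoeff_dotProduct {ι : Type*} [Fintype ι] (hω : 0 < ω) (c : ι → ℝ) {x : ℝ → ι → ℝ}
    (hx : IsContinuousPiece a (a + π / ω) x) :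
    halfCoeff ω a n (fun t => c ⬝ᵥ x t) =
      (fun i => (c i : ℂ)) ⬝ᵥ fun i => halfCoeff ω a n fun t => x t i := by
  have hint (i : ι) : IntervalIntegrable
      (fun t : ℝ => (c i : ℂ) * ((x t i : ℂ) * exp (-(I * n * ω * t)))) volume a (a + π / ω) :=
    ((hx.comp (continuous_apply i)).intervalIntegrable_mul_exp hω n).const_mul _
  simp only [halfCoeff, dotProduct, ofReal_sum, ofReal_mul, Finset.sum_mul, mul_assoc (ofReal _)]
  rw [intervalIntegral.integral_finsetSum fun i _ => hint i, Finset.mul_sum]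
  simp only [intervalIntegral.integral_const_mul]
  exact Finset.sum_congr rfl fun i _ => by ring

/-- The harmonics of the impulse train `δ(t - a)` with alternating signs. -/
def halfKick (ω a : ℝ) (n : ℕ) : ℂ := 2 * I * ((ω / π : ℝ) : ℂ) * exp (-(I * n * ω * a))

theorem halfCoeff_deriv (hω : 0 < ω) (hn : Odd n) (hf : ContinuousOn f (Icc a (a + π / ω)))
    (hg : IsContinuousPiece a (a + π / ω) g)
    (hfg : ∀ t ∈ Ioo a (a + π / ω), HasDerivAt f (g t) t) :
    halfCoeff ω a n g =
      I * n * ω * halfCoeff ω a n f - halfKick ω a n * (f a + f (a + π / ω)) := by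
  have hle : a ≤ a + π / ω := le_add_of_nonneg_right (by positivity)
  have hexp (t : ℝ) : HasDerivAt (fun t : ℝ => exp (-(I * n * ω * t)))
      (exp (-(I * n * ω * t)) * -(I * n * ω * 1)) t :=
    (((hasDerivAt_id (t : ℂ)).const_mul (I * n * ω)).neg.cexp).comp_ofReal
  have hintg := hg.intervalIntegrable_mul_exp hω n
  have hintf := ((IsContinuousPiece.of_continuousOn hf).intervalIntegrable_mul_exp hω n).const_mul
    (-(I * n * ω))
  have hparts := intervalIntegral.integral_eq_sub_of_hasDerivAt_of_le hle
    (f := fun t : ℝ => (f t : ℂ) * exp (-(I * n * ω * t)))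
    ((continuous_ofReal.comp_continuousOn hf).mul (by fun_prop))
    (fun t ht => ((hfg t ht).ofReal_comp.mul (hexp t)).congr_deriv (by ring)) (hintg.add hintf)
  rw [intervalIntegral.integral_add hintg hintf, intervalIntegral.integral_const_mul,
    exp_neg_I_mul_add_half_period hω, hn.neg_one_pow] at hparts
  rw [halfCoeff, halfCoeff, halfKick]
  linear_combination 2 * I * ((ω / π : ℝ) : ℂ) * hparts

theorem halfCoeff_state {d : ℕ} {A : Matrix (Fin d) (Fin d) ℝ} {B : Fin d → ℝ} {u : ℝ → ℝ}
    {x : ℝ → Fin d → ℝ} (hω : 0 < ω) (hn : Odd n) (hA : (pencil A (n * ω)).det ≠ 0)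
    (hu : IsContinuousPiece a (a + π / ω) u) (hx : ContinuousOn x (Icc a (a + π / ω)))
    (hxu : ∀ t ∈ Ioo a (a + π / ω), HasDerivAt x (A *ᵥ x t + u t • B) t) :
    (fun i => halfCoeff ω a n fun t => x t i) =
      (pencil A (n * ω))⁻¹ *ᵥ (halfCoeff ω a n u • (fun i => (B i : ℂ)) +
        halfKick ω a n • fun i => ((x a + x (a + π / ω)) i : ℂ)) := by
  have hpiece := IsContinuousPiece.of_continuousOn hx
  have hAx (i : Fin d) : IsContinuousPiece a (a + π / ω) fun t => A i ⬝ᵥ x t :=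
    hpiece.comp (φ := fun v => A i ⬝ᵥ v) (by fun_prop)
  have hBu (i : Fin d) : IsContinuousPiece a (a + π / ω) fun t => B i * u t :=
    hu.comp (continuous_const_mul (B i))
  suffices h : pencil A (n * ω) *ᵥ (fun i => halfCoeff ω a n fun t => x t i) =
      halfCoeff ω a n u • (fun i => (B i : ℂ)) +
        halfKick ω a n • fun i => ((x a + x (a + π / ω)) i : ℂ) by
    rw [← h, mulVec_mulVec, nonsing_inv_mul _ (isUnit_iff_ne_zero.2 hA), one_mulVec]
  ext i
  have hcoord := halfCoeff_deriv hω hn (continuousOn_pi.1 hx i)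
    (((hAx i).prodMk (hBu i)).comp (φ := fun p : ℝ × ℝ => p.1 + p.2) (by fun_prop))
    fun t ht => (hasDerivAt_pi.1 (hxu t ht) i).congr_deriv (by simp [mulVec, mul_comm])
  rw [halfCoeff_add hω (hAx i) (hBu i), halfCoeff_const_mul, halfCoeff_dotProduct hω _ hpiece]
    at hcoord
  rw [pencil, sub_mulVec, smul_mulVec, one_mulVec]
  simp only [Pi.sub_apply, Pi.add_apply, Pi.smul_apply, smul_eq_mul, mulVec, Matrix.map_apply]
  push_cast
  linear_combination -hcoord

end HalfCoeff

section HalfWave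

/-- A half-wave symmetric signal (`f (t + π/ω) = -f t`) that can jump only at `a` and its
translates by multiples of `π/ω`. -/
structure IsHalfWave {E : Type*} [TopologicalSpace E] [Neg E] (ω a : ℝ) (f : ℝ → E) : Prop where
  antiperiodic : Antiperiodic f (π / ω)
  isContinuousPiece : IsContinuousPiece a (a + π / ω) f

namespace IsHalfWave

variable {E F : Type*} [TopologicalSpace E] [TopologicalSpace F] {ω a : ℝ}

theorem comp [Neg E] [Neg F] {f : ℝ → E} {φ : E → F} (hφ : Continuous φ) (hodd : ∀ v, φ (-v) = -φ v)
    (hf : IsHalfWave ω a f) : IsHalfWave ω a fun t => φ (f t) :=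
  ⟨fun t => by rw [hf.antiperiodic, hodd], hf.isContinuousPiece.comp hφ⟩

theorem prodMk [Neg E] [Neg F] {f : ℝ → E} {g : ℝ → F} (hf : IsHalfWave ω a f)
    (hg : IsHalfWave ω a g) : IsHalfWave ω a fun t => (f t, g t) :=
  ⟨fun t => Prod.ext (hf.antiperiodic t) (hg.antiperiodic t),
    hf.isContinuousPiece.prodMk hg.isContinuousPiece⟩

theorem add {f g : ℝ → ℝ} (hf : IsHalfWave ω a f) (hg : IsHalfWave ω a g) :
    IsHalfWave ω a fun t => f t + g t :=
  (hf.prodMk hg).comp (φ := fun p : ℝ × ℝ => p.1 + p.2) (by fun_prop)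
    fun p => (neg_add p.1 p.2).symm

end IsHalfWave

variable {ω a : ℝ} {f g : ℝ → ℝ}

theorem IsHalfWave.harmonicCoeff_eq (hf : IsHalfWave ω a f) (hω : 0 < ω) (n : ℕ) :
    harmonicCoeff ω n f = (1 - (-1) ^ n) / 2 * halfCoeff ω a n f := by
  set h := π / ω with hh
  set φ : ℝ → ℂ := fun t => (f t : ℂ) * exp (-(I * n * ω * t)) with hφ
  have hshift (t : ℝ) : φ (t + h) = -(-1) ^ n * φ t := by
    rw [hφ, hh]
    beta_reduce
    rw [hf.antiperiodic t, exp_neg_I_mul_add_half_period hω n t]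
    push_cast
    ring
  have hper : Periodic φ (h + h) := fun t => by
    rw [← add_assoc, hshift, hshift, ← mul_assoc, neg_mul_neg, ← mul_pow]
    simp
  have hint : IntervalIntegrable φ volume a (a + h) :=
    hf.isContinuousPiece.intervalIntegrable_mul_exp hω n
  have hint' : IntervalIntegrable φ volume (a + h) (a + h + h) := by
    have hint_shift : IntervalIntegrable (fun t => φ (t + h)) volume a (a + h) := by
      simp_rw [hshift]
      exact hint.const_mul _
    simpa using hint_shift.comp_sub_right h
  have hfull : ∫ t in (0 : ℝ)..(2 * π / ω), φ t = (1 - (-1) ^ n) * ∫ t in a..a + h, φ t := by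
    rw [show 2 * π / ω = 0 + (h + h) by rw [hh]; ring, hper.intervalIntegral_add_eq 0 a,
      ← add_assoc, ← intervalIntegral.integral_add_adjacent_intervals hint hint',
      ← intervalIntegral.integral_comp_add_right φ h]
    simp_rw [hshift]
    rw [intervalIntegral.integral_const_mul]
    ring
  rw [harmonicCoeff, hfull, halfCoeff]
  ring

theorem IsHalfWave.harmonicCoeff_of_even (hf : IsHalfWave ω a f) (hω : 0 < ω) {n : ℕ}
    (hn : Even n) : harmonicCoeff ω n f = 0 := by
  rw [hf.harmonicCoeff_eq hω, hn.neg_one_pow, sub_self, zero_div, zero_mul]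

theorem IsHalfWave.harmonicCoeff_of_odd (hf : IsHalfWave ω a f) (hω : 0 < ω) {n : ℕ}
    (hn : Odd n) : harmonicCoeff ω n f = halfCoeff ω a n f := by
  rw [hf.harmonicCoeff_eq hω, hn.neg_one_pow]
  ring

theorem IsHalfWave.harmonicCoeff_add (hf : IsHalfWave ω a f) (hg : IsHalfWave ω a g) (hω : 0 < ω)
    (n : ℕ) :
    harmonicCoeff ω n (fun t => f t + g t) = harmonicCoeff ω n f + harmonicCoeff ω n g := by
  rw [hf.harmonicCoeff_eq hω, hg.harmonicCoeff_eq hω, (hf.add hg).harmonicCoeff_eq hω,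
    halfCoeff_add hω hf.isContinuousPiece hg.isContinuousPiece, mul_add]

theorem isHalfWave_const_mul_sin (hω : ω ≠ 0) (a D : ℝ) :
    IsHalfWave ω a fun t => D * Real.sin (ω * t) where
  antiperiodic t := by
    beta_reduce
    rw [mul_add, mul_div_cancel₀ π hω, Real.sin_add_pi, mul_neg]
  isContinuousPiece := .of_continuousOn (by fun_prop)

theorem integral_exp_int_mul (hω : ω ≠ 0) (k : ℤ) :
    ∫ t in (0 : ℝ)..(2 * π / ω), exp (I * k * ω * t) = if k = 0 then 2 * π / ω else 0 := by
  split_ifs with hk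
  · simp [hk]
  have hω' : (ω : ℂ) ≠ 0 := by exact_mod_cast hω
  have hc : I * k * ω ≠ 0 := by simp [hk, hω]
  rw [integral_exp_mul_complex hc,
    show I * k * ω * ((2 * π / ω : ℝ) : ℂ) = k * (2 * π * I) by push_cast; field_simp,
    exp_int_mul_two_pi_mul_I]
  simp

theorem harmonicCoeff_const_mul_sin (hω : ω ≠ 0) (D : ℝ) {m : ℕ} (hm : m ≠ 0) (n : ℕ) :
    harmonicCoeff ω n (fun t => D * Real.sin (m * ω * t)) = if n = m then (D : ℂ) else 0 := by
  have hsplit (t : ℝ) : ((D * Real.sin (m * ω * t) : ℝ) : ℂ) * exp (-(I * n * ω * t)) =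
      D * I / 2 * (exp (I * (-(m + n) : ℤ) * ω * t) - exp (I * (m - n : ℤ) * ω * t)) := by
    have hneg : exp (I * (-(m + n) : ℤ) * ω * t) =
        exp (-(m * ω * t) * I) * exp (-(I * n * ω * t)) := by
      rw [← exp_add]; push_cast; ring_nf
    have hpos : exp (I * (m - n : ℤ) * ω * t) = exp (m * ω * t * I) * exp (-(I * n * ω * t)) := by
      rw [← exp_add]; push_cast; ring_nf
    rw [hneg, hpos, ofReal_mul, ofReal_sin, Complex.sin]
    push_cast
    ring
  simp_rw [harmonicCoeff, hsplit]
  rw [intervalIntegral.integral_const_mul, intervalIntegral.integral_sub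
    (Continuous.intervalIntegrable (by fun_prop) _ _)
    (Continuous.intervalIntegrable (by fun_prop) _ _),
    integral_exp_int_mul hω, integral_exp_int_mul hω, if_neg (by omega)]
  have hω' : (ω : ℂ) ≠ 0 := by exact_mod_cast hω
  by_cases hnm : n = m
  · have hπ : (π : ℂ) ≠ 0 := by exact_mod_cast Real.pi_ne_zero
    rw [if_pos (by omega), if_pos hnm]
    push_cast
    field_simp
    linear_combination -2 * π * (D : ℂ) * I_sq
  · rw [if_neg (by omega), if_neg hnm]
    ring

end HalfWave

section FourierInversion

variable {ω a : ℝ} {f : ℝ → ℝ}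

theorem hasSum_fourierCoeff_liftIco {T : ℝ} [hT : Fact (0 < T)] {φ : ℝ → ℂ}
    (hφ : ContinuousOn φ (Icc a (a + T))) (hend : φ a = φ (a + T))
    (hsum : Summable (fourierCoeff (AddCircle.liftIco T a φ))) :
    HasSum (fun n : ℤ => fourierCoeff (AddCircle.liftIco T a φ) n * exp (2 * π * I * n * a / T))
      (φ a) := by
  let Φ : C(AddCircle T, ℂ) := ⟨AddCircle.liftIco T a φ, AddCircle.liftIco_continuous hend hφ⟩
  have hval : Φ a = φ a :=
    AddCircle.liftIco_coe_apply (left_mem_Ico.2 (lt_add_of_pos_right a hT.out))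
  have hseries := has_pointwise_sum_fourier_series_of_summable (f := Φ) hsum (a : AddCircle T)
  simp only [hval, smul_eq_mul, fourier_coe_apply] at hseries
  exact hseries

/-- The coefficients, indexed by `k ∈ ℤ`, of `exp (j (2k + 1) ω t)` in the Fourier series of a
real half-wave signal: the Fourier coefficients of `f exp (-j ω t)`, which has period `π/ω`. -/
def oddFourierCoeff (ω a : ℝ) (f : ℝ → ℝ) (k : ℤ) : ℂ :=
  ((ω / π : ℝ) : ℂ) * ∫ t in a..a + π / ω, (f t : ℂ) * exp (-(I * (2 * k + 1) * ω * t))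

theorem fourierCoeff_liftIco_mul_exp [hT : Fact (0 < π / ω)] (k : ℤ) :
    fourierCoeff (AddCircle.liftIco (π / ω) a fun t => (f t : ℂ) * exp (-(I * ω * t))) k =
      oddFourierCoeff ω a f k := by
  have hω : (ω : ℂ) ≠ 0 := by
    have hne := hT.out.ne'
    exact_mod_cast fun h => hne (by rw [h, div_zero])
  have hπ : (π : ℂ) ≠ 0 := by exact_mod_cast Real.pi_ne_zero
  rw [fourierCoeff_liftIco_eq, fourierCoeffOn_eq_integral, oddFourierCoeff, add_sub_cancel_left,
    real_smul]
  congr 1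
  · push_cast
    field_simp
  · refine intervalIntegral.integral_congr fun t _ => ?_
    simp only [fourier_coe_apply, smul_eq_mul]
    rw [mul_left_comm, ← exp_add]
    congr 2
    push_cast
    field_simp
    ring

theorem halfCoeff_eq_oddFourierCoeff (k : ℕ) :
    halfCoeff ω a (2 * k + 1) f = 2 * I * oddFourierCoeff ω a f k := by
  rw [halfCoeff, oddFourierCoeff]
  push_cast
  ring

theorem oddFourierCoeff_neg_add_one (k : ℤ) :
    oddFourierCoeff ω a f (-(k + 1)) = starRingEnd ℂ (oddFourierCoeff ω a f k) := by
  rw [oddFourierCoeff, oddFourierCoeff, map_mul, conj_ofReal, intervalIntegral, intervalIntegral,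
    map_sub, ← integral_conj, ← integral_conj]
  simp only [map_mul, conj_ofReal, ← exp_conj, map_neg, conj_I, map_add, map_one, map_intCast,
    map_ofNat]
  push_cast
  ring_nf

theorem hasSum_oddFourierCoeff (hω : 0 < ω) (hf : ContinuousOn f (Icc a (a + π / ω)))
    (hend : f (a + π / ω) = -f a) (hsum : Summable (oddFourierCoeff ω a f)) :
    HasSum (fun k : ℤ => oddFourierCoeff ω a f k * exp (I * (2 * k + 1) * ω * a)) (f a : ℂ) := by
  have : Fact (0 < π / ω) := ⟨by positivity⟩
  have hω' : (ω : ℂ) ≠ 0 := by exact_mod_cast hω.ne'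
  have hπ : (π : ℂ) ≠ 0 := by exact_mod_cast Real.pi_ne_zero
  have hcoeff : fourierCoeff (AddCircle.liftIco (π / ω) a fun t => (f t : ℂ) * exp (-(I * ω * t))) =
      oddFourierCoeff ω a f := funext fun k => fourierCoeff_liftIco_mul_exp k
  have hends : (f a : ℂ) * exp (-(I * ω * a)) =
      f (a + π / ω) * exp (-(I * ω * ((a + π / ω : ℝ) : ℂ))) := by
    have hexp := exp_neg_I_mul_add_half_period hω 1 a
    simp only [Nat.cast_one, mul_one, pow_one] at hexp
    rw [hend, hexp]
    push_cast
    ring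
  have hseries := (hasSum_fourierCoeff_liftIco
    (φ := fun t => (f t : ℂ) * exp (-(I * ω * t))) ((continuous_ofReal.comp_continuousOn hf).mul
      (by fun_prop)) hends (by rwa [hcoeff])).mul_right (exp (I * ω * a))
  rw [hcoeff, mul_assoc (f a : ℂ), ← exp_add, neg_add_cancel, exp_zero, mul_one] at hseries
  refine hseries.congr_fun fun k => ?_
  rw [mul_assoc (oddFourierCoeff ω a f k) (exp _) (exp _), ← exp_add]
  congr 2
  push_cast
  field_simp

theorem hasSum_halfCoeff (hω : 0 < ω) (hf : ContinuousOn f (Icc a (a + π / ω)))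
    (hend : f (a + π / ω) = -f a) (hsum : Summable fun k : ℕ => halfCoeff ω a (2 * k + 1) f) :
    HasSum (fun k : ℕ => (halfCoeff ω a (2 * k + 1) f *
      exp (I * (2 * k + 1 : ℕ) * ω * a)).im) (f a) := by
  have hsum_nat : Summable fun k : ℕ => oddFourierCoeff ω a f k := by
    refine (hsum.mul_left (2 * I)⁻¹).congr fun k => ?_
    rw [halfCoeff_eq_oddFourierCoeff, inv_mul_cancel_left₀ (mul_ne_zero two_ne_zero I_ne_zero)]
  have hsum_neg : Summable fun k : ℕ => oddFourierCoeff ω a f (-(k + 1)) := by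
    simp_rw [oddFourierCoeff_neg_add_one]
    exact conjCLE.summable.2 hsum_nat
  have hseries := (hasSum_oddFourierCoeff hω hf hend
    (hsum_nat.of_nat_of_neg_add_one hsum_neg)).nat_add_neg_add_one
  convert! hasSum_re hseries using 2 with k
  set w := oddFourierCoeff ω a f k * exp (I * (2 * k + 1 : ℕ) * ω * a) with hw
  have hpos : oddFourierCoeff ω a f k * exp (I * (2 * (k : ℤ) + 1) * ω * a) = w := by
    rw [hw]
    push_cast
    rfl
  have hneg : oddFourierCoeff ω a f (-(k + 1)) * exp (I * (2 * (-(k + 1) : ℤ) + 1) * ω * a) =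
      starRingEnd ℂ w := by
    rw [oddFourierCoeff_neg_add_one, hw, map_mul, ← exp_conj]
    congr 2
    simp only [map_mul, conj_I, conj_ofReal, map_natCast]
    push_cast
    ring
  rw [hpos, hneg, halfCoeff_eq_oddFourierCoeff, mul_assoc, ← hw, mul_assoc]
  simp
  ring

end FourierInversion

section Blocks

/-- The resets recur every half period `π/ω`, starting from `a`, and there are no others. -/
structure IsResetCycle (ω a : ℝ) (J : Set ℝ) : Prop where
  mem : a ∈ J
  notMem : ∀ t ∈ Ioo a (a + π / ω), t ∉ J
  add_mem_iff : ∀ t, t + π / ω ∈ J ↔ t ∈ J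

variable {ω a : ℝ} {n : ℕ} {J : Set ℝ}

namespace LTI

variable {G : LTI} {u y : ℝ → ℝ} {x : ℝ → Fin G.dim → ℝ}

theorem halfCoeff_output {p : Fin G.dim → ℝ} (hω : 0 < ω) (hn : Odd n)
    (hG : (pencil G.A (n * ω)).det ≠ 0)
    (hu : IsContinuousPiece a (a + π / ω) u) (hx : ContinuousOn x (Icc a (a + π / ω)))
    (hxu : ∀ t ∈ Ioo a (a + π / ω), HasDerivAt x (G.A *ᵥ x t + u t • G.B) t)
    (hy : ∀ t ∈ Ioc a (a + π / ω), y t = G.C ⬝ᵥ x t + G.D * u t)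
    (hp : x a + x (a + π / ω) = p) :
    halfCoeff ω a n y = G.freq (n * ω) * halfCoeff ω a n u + halfKick ω a n *
      ((fun i => (G.C i : ℂ)) ⬝ᵥ ((pencil G.A (n * ω))⁻¹ *ᵥ fun i => (p i : ℂ))) := by
  have hpiece := IsContinuousPiece.of_continuousOn hx
  rw [halfCoeff_congr hω hy, halfCoeff_add hω
    (hpiece.comp (φ := fun v => G.C ⬝ᵥ v) (by fun_prop)) (hu.comp (continuous_const_mul G.D)),
    halfCoeff_const_mul, halfCoeff_dotProduct hω _ hpiece, halfCoeff_state hω hn hG hu hx hxu,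
    hp, mulVec_add, mulVec_smul, mulVec_smul, dotProduct_add, dotProduct_smul, dotProduct_smul,
    smul_eq_mul, smul_eq_mul, freq]
  ring

namespace Responds

theorem isHalfWave_state (h : G.Responds univ J u x y) (hx : Antiperiodic x (π / ω)) (a : ℝ) :
    IsHalfWave ω a x :=
  ⟨hx, .of_continuousOn (h.1.mono (subset_univ _))⟩

theorem isHalfWave_output (h : G.Responds univ J u x y) (hx : Antiperiodic x (π / ω))
    (hu : IsHalfWave ω a u) : IsHalfWave ω a y := by
  rw [show y = fun t => G.C ⬝ᵥ x t + G.D * u t from funext fun t => h.2.2 t (mem_univ t)]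
  exact ((h.isHalfWave_state hx a).comp (φ := fun v => G.C ⬝ᵥ v) (by fun_prop)
    (dotProduct_neg _)).add (hu.comp (continuous_const_mul G.D) fun v => mul_neg G.D v)

theorem harmonicCoeff_output (h : G.Responds univ J u x y) (hx : Antiperiodic x (π / ω))
    (hu : IsHalfWave ω a u) (hJ : IsResetCycle ω a J) (hω : 0 < ω) (hn : Odd n)
    (hG : (pencil G.A (n * ω)).det ≠ 0) :
    harmonicCoeff ω n y = G.freq (n * ω) * harmonicCoeff ω n u := by
  have hzero : (fun i => ((0 : Fin G.dim → ℝ) i : ℂ)) = 0 := funext fun _ => ofReal_zero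
  rw [(h.isHalfWave_output hx hu).harmonicCoeff_of_odd hω hn, hu.harmonicCoeff_of_odd hω hn,
    halfCoeff_output hω hn hG hu.isContinuousPiece (h.1.mono (subset_univ _))
      (fun t ht => h.2.1 t ⟨mem_univ t, hJ.notMem t ht⟩) (fun t _ => h.2.2 t (mem_univ t))
      (by rw [hx a, add_neg_cancel]), hzero, mulVec_zero, dotProduct_zero, mul_zero, add_zero]

end Responds

end LTI

namespace ResetController

variable {R : ResetController} {z m : ℝ → ℝ} {x : ℝ → Fin (R.k + 1) → ℝ}

/-- The state `x` with its value at the reset instant `a` replaced by the value after the reset, so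
that it is continuous up to `a` from the right. -/
def afterReset (R : ResetController) (a : ℝ) (x : ℝ → Fin (R.k + 1) → ℝ) :
    ℝ → Fin (R.k + 1) → ℝ :=
  update x a (R.Aρ *ᵥ x a)

theorem afterReset_self : R.afterReset a x a = R.Aρ *ᵥ x a := update_self ..

theorem afterReset_of_gt {t : ℝ} (ht : a < t) : R.afterReset a x t = x t :=
  update_of_ne ht.ne' ..

namespace Responds

theorem continuousOn_afterReset (h : R.Responds univ J z x m) (hJ : IsResetCycle ω a J) :
    ContinuousOn (R.afterReset a x) (Icc a (a + π / ω)) := by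
  have hlt {t : ℝ} (ht : t ∈ Icc a (a + π / ω) \ {a}) : a < t :=
    lt_of_le_of_ne ht.1.1 (Ne.symm ht.2)
  refine continuousOn_update_iff.2 ⟨fun t ht => ?_, fun _ => ?_⟩
  · rcases ht.1.2.lt_or_eq with hend | rfl
    · exact (h.1 t ⟨mem_univ t, hJ.notMem t ⟨hlt ht, hend⟩⟩).continuousAt.continuousWithinAt
    · have hleft : ContinuousWithinAt x (Iio (a + π / ω)) (a + π / ω) :=
        (h.2.1 _ ⟨mem_univ _, (hJ.add_mem_iff a).2 hJ.mem⟩).1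
      exact (continuousWithinAt_Iio_iff_Iic.1 hleft).mono fun s hs => hs.1.2
  · exact (h.2.1 a ⟨mem_univ a, hJ.mem⟩).2.mono_left (nhdsWithin_mono _ fun t ht => hlt ht)

theorem hasDerivAt_afterReset (h : R.Responds univ J z x m) (hJ : IsResetCycle ω a J) {t : ℝ}
    (ht : t ∈ Ioo a (a + π / ω)) :
    HasDerivAt (R.afterReset a x) (R.A *ᵥ R.afterReset a x t + z t • R.B) t := by
  rw [afterReset_of_gt ht.1]
  refine (h.1 t ⟨mem_univ t, hJ.notMem t ht⟩).congr_of_eventuallyEq ?_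
  filter_upwards [Ioi_mem_nhds ht.1] with s hs using afterReset_of_gt hs

theorem isHalfWave_state (h : R.Responds univ J z x m) (hx : Antiperiodic x (π / ω))
    (hJ : IsResetCycle ω a J) : IsHalfWave ω a x :=
  ⟨hx, _, h.continuousOn_afterReset hJ, fun _ ht => (afterReset_of_gt ht.1).symm⟩

theorem isHalfWave_output (h : R.Responds univ J z x m) (hx : Antiperiodic x (π / ω))
    (hJ : IsResetCycle ω a J) (hz : IsHalfWave ω a z) : IsHalfWave ω a m := by
  rw [show m = fun t => R.C ⬝ᵥ x t + R.D * z t from funext fun t => h.2.2 t (mem_univ t)]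
  exact ((h.isHalfWave_state hx hJ).comp (φ := fun v => R.C ⬝ᵥ v) (by fun_prop)
    (dotProduct_neg _)).add (hz.comp (continuous_const_mul R.D) fun v => mul_neg R.D v)

/-- The jump `(A_ρ - I) x_r(a)` acts on the base-linear controller as an impulsive input that
alternates in sign. -/
theorem harmonicCoeff_output (h : R.Responds univ J z x m) (hx : Antiperiodic x (π / ω))
    (hJ : IsResetCycle ω a J) (hz : IsHalfWave ω a z) (hω : 0 < ω) (hn : Odd n)
    (hR : (pencil R.A (n * ω)).det ≠ 0) :
    harmonicCoeff ω n m = R.base.freq (n * ω) * harmonicCoeff ω n z +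
      2 * (R.Δx (n * ω) ⬝ᵥ fun i => (((R.Aρ - 1) *ᵥ x a) i : ℂ)) / (n * π) *
        exp (-(I * n * ω * a)) := by
  have hT : a < a + π / ω := lt_add_of_pos_right a (by positivity)
  have hjump : R.afterReset a x a + R.afterReset a x (a + π / ω) = (R.Aρ - 1) *ᵥ x a := by
    rw [afterReset_self, afterReset_of_gt hT, hx a, sub_mulVec, one_mulVec, sub_eq_add_neg]
  have hout := LTI.halfCoeff_output (G := R.base) hω hn hR hz.isContinuousPiece
    (h.continuousOn_afterReset hJ) (fun t ht => h.hasDerivAt_afterReset hJ ht) (y := m)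
    (fun t ht => by rw [afterReset_of_gt ht.1]; exact h.2.2 t (mem_univ t)) hjump
  have hn' : (n : ℂ) ≠ 0 := by exact_mod_cast hn.pos.ne'
  have hπ : (π : ℂ) ≠ 0 := by exact_mod_cast Real.pi_ne_zero
  rw [(h.isHalfWave_output hx hJ hz).harmonicCoeff_of_odd hω hn, hz.harmonicCoeff_of_odd hω hn,
    hout, halfKick, Δx, smul_dotProduct, dotProduct_mulVec, smul_eq_mul]
  simp only [base]
  push_cast
  field_simp
  rfl

end Responds

end ResetController

end Blocks

section BaseState

variable {ω a : ℝ} {J : Set ℝ}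

open scoped Matrix.Norms.Operator in
theorem hasDerivAt_exp_smul_mulVec {d : ℕ} (A : Matrix (Fin d) (Fin d) ℝ) (g : Fin d → ℝ)
    (a t : ℝ) :
    HasDerivAt (fun t : ℝ => NormedSpace.exp ((t - a) • A) *ᵥ g)
      (A *ᵥ (NormedSpace.exp ((t - a) • A) *ᵥ g)) t := by
  have hexp := (hasDerivAt_exp_smul_const' (𝕂 := ℝ) A (t - a)).comp_sub_const t a
  let L : Matrix (Fin d) (Fin d) ℝ →L[ℝ] (Fin d → ℝ) :=
    LinearMap.toContinuousLinearMap ((mulVecBilin ℝ ℝ).flip g)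
  rw [mulVec_mulVec]
  exact L.hasFDerivAt.comp_hasDerivAt t hexp

/-- A kernel vector `g` would start an antiperiodic solution `exp (t A) g` of `x' = A x`, all of
whose Fourier coefficients vanish. -/
theorem det_one_add_exp_ne_zero {d : ℕ} (A : Matrix (Fin d) (Fin d) ℝ) (hω : 0 < ω)
    (hA : ∀ n : ℕ, Odd n → (pencil A (n * ω)).det ≠ 0) :
    (1 + NormedSpace.exp ((π / ω) • A)).det ≠ 0 := by
  intro hdet
  obtain ⟨g, hg0, hg⟩ := exists_mulVec_eq_zero_iff.2 hdet
  set x : ℝ → Fin d → ℝ := fun t => NormedSpace.exp ((t - 0) • A) *ᵥ g with hx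
  have hder (t : ℝ) : HasDerivAt x (A *ᵥ x t) t := hasDerivAt_exp_smul_mulVec A g 0 t
  have hcont : Continuous x := continuous_iff_continuousAt.2 fun t => (hder t).continuousAt
  have hx0 : x 0 = g := by simp [hx]
  have hend : x (0 + π / ω) = -x 0 := by
    rw [add_mulVec, one_mulVec] at hg
    rw [hx0]
    simpa only [hx, zero_add, sub_zero] using eq_neg_of_add_eq_zero_right hg
  have hzero (n : ℕ) (hn : Odd n) (i : Fin d) : halfCoeff ω 0 n (fun t => x t i) = 0 := by
    have hstate := halfCoeff_state (a := 0) (B := 0) (u := fun _ => 0) hω hn (hA n hn)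
      (.of_continuousOn continuousOn_const) hcont.continuousOn fun t _ => by simpa using hder t
    have hends : (fun i => ((x 0 + x (0 + π / ω)) i : ℂ)) = 0 := by
      rw [hend, add_neg_cancel]
      exact funext fun _ => ofReal_zero
    have hB : (fun i => ((0 : Fin d → ℝ) i : ℂ)) = 0 := funext fun _ => ofReal_zero
    rw [hends, hB, smul_zero, smul_zero, add_zero, mulVec_zero] at hstate
    exact congrFun hstate i
  refine hg0 (funext fun i => ?_)
  have hseries := hasSum_halfCoeff hω (continuousOn_pi.1 hcont.continuousOn i) (congrFun hend i)
    (by simp_rw [hzero _ ⟨_, rfl⟩]; exact summable_zero)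
  simp_rw [hzero _ ⟨_, rfl⟩, zero_mul, zero_im] at hseries
  rw [← hx0]
  exact hseries.unique hasSum_zero

namespace ResetController

variable {R : ResetController} {z m : ℝ → ℝ} {x : ℝ → Fin (R.k + 1) → ℝ}

/-- The transient `(I + exp (A_R π/ω))⁻¹ (A_ρ - I) ξ` that a reset from the state `ξ` superposes on
the base-linear steady state. Half a period later the opposite jump turns what is left of it into
its negative. -/
def transient (R : ResetController) (ω : ℝ) (ξ : Fin (R.k + 1) → ℝ) : Fin (R.k + 1) → ℝ :=
  (1 + R.expHalf ω)⁻¹ *ᵥ ((R.Aρ - 1) *ᵥ ξ)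

/-- The state of the base-linear steady state at a reset instant, in terms of the state `ξ` of the
reset controller just before the reset. -/
def baseState (R : ResetController) (ω : ℝ) (ξ : Fin (R.k + 1) → ℝ) : Fin (R.k + 1) → ℝ :=
  R.Aρ *ᵥ ξ - R.transient ω ξ

/-- The base-linear steady state on the half period after the reset instant `a`, in terms of the
state `x` of the reset controller. -/
def baseMotion (R : ResetController) (ω a : ℝ) (x : ℝ → Fin (R.k + 1) → ℝ) (t : ℝ) :
    Fin (R.k + 1) → ℝ :=
  R.afterReset a x t - NormedSpace.exp ((t - a) • R.A) *ᵥ R.transient ω (x a)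

theorem transient_add_expHalf_mulVec (hE : (1 + R.expHalf ω).det ≠ 0) (ξ : Fin (R.k + 1) → ℝ) :
    R.transient ω ξ + R.expHalf ω *ᵥ R.transient ω ξ = (R.Aρ - 1) *ᵥ ξ := by
  have h : (1 + R.expHalf ω) *ᵥ R.transient ω ξ = (R.Aρ - 1) *ᵥ ξ := by
    rw [transient, mulVec_mulVec, mul_nonsing_inv _ hE.isUnit, one_mulVec]
  rwa [add_mulVec, one_mulVec] at h

theorem jump_eq_mulVec_baseState (hE : (1 + R.expHalf ω).det ≠ 0)
    (hdet : (R.Aρ * R.expHalf ω + 1).det ≠ 0) (ξ : Fin (R.k + 1) → ℝ) :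
    (R.Aρ - 1) *ᵥ ξ = ((1 + R.expHalf ω) * (R.Aρ * R.expHalf ω + 1)⁻¹ * (R.Aρ - 1)) *ᵥ
      R.baseState ω ξ := by
  set E := R.expHalf ω
  set p := (R.Aρ - 1) *ᵥ ξ with hp
  set g := R.transient ω ξ with hg
  have hgp : g + E *ᵥ g = p := transient_add_expHalf_mulVec hE ξ
  have hAξ : R.Aρ *ᵥ ξ = p + ξ := by rw [hp, sub_mulVec, one_mulVec, sub_add_cancel]
  have hbase : (R.Aρ - 1) *ᵥ R.baseState ω ξ = (R.Aρ * E + 1) *ᵥ g := by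
    rw [baseState, ← hg, add_mulVec, ← mulVec_mulVec, eq_sub_of_add_eq' hgp, mulVec_sub,
      mulVec_sub, hAξ, mulVec_add, ← hp, one_mulVec, sub_mulVec, sub_mulVec, one_mulVec, one_mulVec]
    abel
  rw [← mulVec_mulVec, ← mulVec_mulVec, hbase, mulVec_mulVec g, nonsing_inv_mul _ hdet.isUnit,
    one_mulVec, add_mulVec, one_mulVec, hgp]

theorem baseMotion_self : R.baseMotion ω a x a = R.baseState ω (x a) := by
  rw [baseMotion, baseState, afterReset_self, sub_self, zero_smul, NormedSpace.exp_zero, one_mulVec]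

theorem baseMotion_add_half_period (hω : 0 < ω) (hE : (1 + R.expHalf ω).det ≠ 0)
    (hx : Antiperiodic x (π / ω)) :
    R.baseMotion ω a x (a + π / ω) = -R.baseState ω (x a) := by
  have hjump := transient_add_expHalf_mulVec hE (x a)
  rw [sub_mulVec, one_mulVec] at hjump
  rw [baseMotion, afterReset_of_gt (lt_add_of_pos_right a (by positivity)), hx, add_sub_cancel_left,
    ← expHalf, eq_sub_of_add_eq' hjump, baseState]
  abel

theorem Responds.continuousOn_baseMotion (h : R.Responds univ J z x m)
    (hJ : IsResetCycle ω a J) : ContinuousOn (R.baseMotion ω a x) (Icc a (a + π / ω)) :=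
  (h.continuousOn_afterReset hJ).sub fun t _ =>
    (hasDerivAt_exp_smul_mulVec R.A _ a t).continuousAt.continuousWithinAt

theorem Responds.hasDerivAt_baseMotion (h : R.Responds univ J z x m) (hJ : IsResetCycle ω a J)
    {t : ℝ} (ht : t ∈ Ioo a (a + π / ω)) :
    HasDerivAt (R.baseMotion ω a x) (R.A *ᵥ R.baseMotion ω a x t + z t • R.B) t := by
  refine ((h.hasDerivAt_afterReset hJ ht).sub
    (hasDerivAt_exp_smul_mulVec R.A _ a t)).congr_deriv ?_
  rw [baseMotion, mulVec_sub]
  abel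

theorem Responds.halfCoeff_baseMotion {n : ℕ} (h : R.Responds univ J z x m)
    (hx : Antiperiodic x (π / ω)) (hJ : IsResetCycle ω a J)
    (hz : IsContinuousPiece a (a + π / ω) z) (hω : 0 < ω) (hn : Odd n)
    (hE : (1 + R.expHalf ω).det ≠ 0) (hR : (pencil R.A (n * ω)).det ≠ 0) (i : Fin (R.k + 1)) :
    halfCoeff ω a n (fun t => R.baseMotion ω a x t i) = R.Δl (n * ω) i * halfCoeff ω a n z := by
  have hzero : (fun i => ((0 : Fin (R.k + 1) → ℝ) i : ℂ)) = 0 := funext fun _ => ofReal_zero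
  have hstate := halfCoeff_state hω hn hR hz (h.continuousOn_baseMotion hJ)
    fun t ht => h.hasDerivAt_baseMotion hJ ht
  rw [baseMotion_self, baseMotion_add_half_period hω hE hx, add_neg_cancel, hzero, smul_zero,
    add_zero, mulVec_smul] at hstate
  rw [congrFun hstate i, Pi.smul_apply, smul_eq_mul, mul_comm]
  rfl

theorem Responds.hasSum_baseState (h : R.Responds univ J z x m) (hx : Antiperiodic x (π / ω))
    (hJ : IsResetCycle ω a J) (hz : IsHalfWave ω a z) (hω : 0 < ω)
    (hR : ∀ n : ℕ, Odd n → (pencil R.A (n * ω)).det ≠ 0) (i : Fin (R.k + 1))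
    (hsum : Summable fun k : ℕ =>
      R.Δl ((2 * k + 1 : ℕ) * ω) i * harmonicCoeff ω (2 * k + 1) z) :
    HasSum (fun k : ℕ => (R.Δl ((2 * k + 1 : ℕ) * ω) i * harmonicCoeff ω (2 * k + 1) z *
      exp (I * (2 * k + 1 : ℕ) * ω * a)).im) (R.baseState ω (x a) i) := by
  have hE : (1 + R.expHalf ω).det ≠ 0 := det_one_add_exp_ne_zero R.A hω hR
  have hcoeff (k : ℕ) : halfCoeff ω a (2 * k + 1) (fun t => R.baseMotion ω a x t i) =
      R.Δl ((2 * k + 1 : ℕ) * ω) i * harmonicCoeff ω (2 * k + 1) z := by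
    rw [h.halfCoeff_baseMotion hx hJ hz.isContinuousPiece hω ⟨k, rfl⟩ hE (hR _ ⟨k, rfl⟩),
      hz.harmonicCoeff_of_odd hω ⟨k, rfl⟩]
  have hend : R.baseMotion ω a x (a + π / ω) i = -R.baseMotion ω a x a i := by
    rw [baseMotion_add_half_period hω hE hx, baseMotion_self, Pi.neg_apply]
  simp_rw [← hcoeff] at hsum ⊢
  rw [← baseMotion_self]
  exact hasSum_halfCoeff hω (continuousOn_pi.1 (h.continuousOn_baseMotion hJ) i) hend hsum

end ResetController
end BaseState

section Superposition

theorem eq_zero_of_periodic_of_tendsto {E : Type*} [TopologicalSpace E] [T2Space E] [Zero E]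
    {f : ℝ → E} {T : ℝ} (hf : Periodic f T) (hT : 0 < T) (h : Tendsto f atTop (𝓝 0)) (t : ℝ) :
    f t = 0 := by
  have htime : Tendsto (fun n : ℕ => t + n * T) atTop atTop :=
    tendsto_atTop_add_const_left _ _ (tendsto_natCast_atTop_atTop.atTop_mul_const hT)
  refine tendsto_nhds_unique ?_ (h.comp htime)
  simp only [comp_def, hf.nat_mul _ t, tendsto_const_nhds]

namespace LTI

variable {G : LTI} {T T' J : Set ℝ} {u u' y y' : ℝ → ℝ} {x x' : ℝ → Fin G.dim → ℝ}

theorem Responds.mono (h : G.Responds T J u x y) (hT : T' ⊆ T) : G.Responds T' J u x y :=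
  ⟨h.1.mono hT, fun t ht => h.2.1 t ⟨hT ht.1, ht.2⟩, fun t ht => h.2.2 t (hT ht)⟩

theorem Responds.add (h : G.Responds T J u x y) (h' : G.Responds T J u' x' y') :
    G.Responds T J (fun t => u t + u' t) (fun t => x t + x' t) (fun t => y t + y' t) := by
  refine ⟨h.1.add h'.1, fun t ht => ?_, fun t ht => ?_⟩
  · refine ((h.2.1 t ht).add (h'.2.1 t ht)).congr_deriv ?_
    rw [mulVec_add, add_smul]
    abel
  · beta_reduce
    rw [h.2.2 t ht, h'.2.2 t ht, dotProduct_add]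
    ring

theorem Responds.neg_shift (h : G.Responds univ J u x y) {c : ℝ} (hJ : ∀ t, t + c ∈ J ↔ t ∈ J) :
    G.Responds univ J (fun t => -u (t + c)) (fun t => -x (t + c)) (fun t => -y (t + c)) := by
  refine ⟨?_, fun t ht => ?_, fun t _ => ?_⟩
  · exact (((continuousOn_univ.1 h.1).comp (continuous_add_const c)).neg).continuousOn
  · have hder := h.2.1 (t + c) ⟨mem_univ _, mt (hJ t).1 ht.2⟩
    refine (hder.comp_add_const t c).neg.congr_deriv ?_
    rw [mulVec_neg, neg_smul]
    abel
  · beta_reduce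
    rw [h.2.2 (t + c) (mem_univ _), dotProduct_neg]
    ring

end LTI

namespace ResetController

variable {R : ResetController} {T T' J : Set ℝ} {z z' m m' : ℝ → ℝ}
  {x x' : ℝ → Fin (R.k + 1) → ℝ}

theorem Responds.mono (h : R.Responds T J z x m) (hT : T' ⊆ T) : R.Responds T' J z x m :=
  ⟨fun t ht => h.1 t ⟨hT ht.1, ht.2⟩, fun t ht => h.2.1 t ⟨hT ht.1, ht.2⟩,
    fun t ht => h.2.2 t (hT ht)⟩

theorem Responds.add (h : R.Responds T J z x m) (h' : R.Responds T J z' x' m') :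
    R.Responds T J (fun t => z t + z' t) (fun t => x t + x' t) (fun t => m t + m' t) := by
  refine ⟨fun t ht => ?_, fun t ht => ⟨(h.2.1 t ht).1.add (h'.2.1 t ht).1, ?_⟩, fun t ht => ?_⟩
  · refine ((h.1 t ht).add (h'.1 t ht)).congr_deriv ?_
    rw [mulVec_add, add_smul]
    abel
  · rw [mulVec_add]
    exact (h.2.1 t ht).2.add (h'.2.1 t ht).2
  · beta_reduce
    rw [h.2.2 t ht, h'.2.2 t ht, dotProduct_add]
    ring

theorem Responds.neg_shift (h : R.Responds univ J z x m) {c : ℝ} (hJ : ∀ t, t + c ∈ J ↔ t ∈ J) :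
    R.Responds univ J (fun t => -z (t + c)) (fun t => -x (t + c)) (fun t => -m (t + c)) := by
  refine ⟨fun t ht => ?_, fun t ht => ?_, fun t _ => ?_⟩
  · have hder := h.1 (t + c) ⟨mem_univ _, mt (hJ t).1 ht.2⟩
    refine (hder.comp_add_const t c).neg.congr_deriv ?_
    rw [mulVec_neg, neg_smul]
    abel
  · obtain ⟨hleft, hright⟩ := h.2.1 (t + c) ⟨mem_univ _, (hJ t).2 ht.2⟩
    have hshift : ContinuousAt (· + c) t := (continuous_add_const c).continuousAt
    rw [mulVec_neg]
    exact ⟨(hleft.comp (hshift.continuousWithinAt.tendsto_nhdsWithin fun s hs =>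
        add_lt_add_left (mem_Iio.1 hs) c)).neg,
      (hright.comp (hshift.continuousWithinAt.tendsto_nhdsWithin fun s hs =>
        add_lt_add_left (mem_Ioi.1 hs) c)).neg⟩
  · beta_reduce
    rw [h.2.2 (t + c) (mem_univ _), dotProduct_neg]
    ring

end ResetController

namespace ResetLoop

variable {S : ResetLoop} {T T' J : Set ℝ} {r r' d d' : ℝ → ℝ} {X X' : S.Trajectory}

/-- The superposition of two trajectories. -/
def Trajectory.add (X X' : S.Trajectory) : S.Trajectory where
  xr t := X.xr t + X'.xr t
  x1 t := X.x1 t + X'.x1 t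
  x2 t := X.x2 t + X'.x2 t
  x3 t := X.x3 t + X'.x3 t
  x4 t := X.x4 t + X'.x4 t
  xs t := X.xs t + X'.xs t
  xP t := X.xP t + X'.xP t
  e t := X.e t + X'.e t
  z t := X.z t + X'.z t
  zs t := X.zs t + X'.zs t
  m t := X.m t + X'.m t
  a t := X.a t + X'.a t
  u t := X.u t + X'.u t
  y t := X.y t + X'.y t
  f t := X.f t + X'.f t

/-- The trajectory `-X (t + c)`. Half-wave symmetry with half period `c` is invariance under this
operation. -/
def Trajectory.negShift (X : S.Trajectory) (c : ℝ) : S.Trajectory where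
  xr t := -X.xr (t + c)
  x1 t := -X.x1 (t + c)
  x2 t := -X.x2 (t + c)
  x3 t := -X.x3 (t + c)
  x4 t := -X.x4 (t + c)
  xs t := -X.xs (t + c)
  xP t := -X.xP (t + c)
  e t := -X.e (t + c)
  z t := -X.z (t + c)
  zs t := -X.zs (t + c)
  m t := -X.m (t + c)
  a t := -X.a (t + c)
  u t := -X.u (t + c)
  y t := -X.y (t + c)
  f t := -X.f (t + c)

theorem IsResponse.mono (h : S.IsResponse T J r d X) (hT : T' ⊆ T) : S.IsResponse T' J r d X where
  c1 := h.c1.mono hT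
  cs := h.cs.mono hT
  cr := h.cr.mono hT
  c2 := h.c2.mono hT
  c3 := h.c3.mono hT
  p := h.p.mono hT
  c4 := h.c4.mono hT
  err t ht := h.err t (hT ht)

theorem IsResponse.add (h : S.IsResponse T J r d X) (h' : S.IsResponse T J r' d' X') :
    S.IsResponse T J (fun t => r t + r' t) (fun t => d t + d' t) (X.add X') where
  c1 := h.c1.add h'.c1
  cs := h.cs.add h'.cs
  cr := h.cr.add h'.cr
  c2 := h.c2.add h'.c2
  c3 := by simpa only [Trajectory.add, add_add_add_comm] using h.c3.add h'.c3
  p := by simpa only [Trajectory.add, add_add_add_comm] using h.p.add h'.p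
  c4 := h.c4.add h'.c4
  err t ht := by simp only [Trajectory.add, h.err t ht, h'.err t ht]; ring

theorem IsResponse.negShift (h : S.IsResponse univ J r d X) {c : ℝ}
    (hJ : ∀ t, t + c ∈ J ↔ t ∈ J) :
    S.IsResponse univ J (fun t => -r (t + c)) (fun t => -d (t + c)) (X.negShift c) where
  c1 := h.c1.neg_shift hJ
  cs := h.cs.neg_shift hJ
  cr := h.cr.neg_shift hJ
  c2 := h.c2.neg_shift hJ
  c3 := by simpa only [Trajectory.negShift, neg_add] using h.c3.neg_shift hJ
  p := by simpa only [Trajectory.negShift, neg_add] using h.p.neg_shift hJ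
  c4 := h.c4.neg_shift hJ
  err t _ := by simp only [Trajectory.negShift, h.err (t + c) (mem_univ _)]; ring

theorem IsConvergent.state_antiperiodic {h : ℝ} (hh : 0 < h) (hconv : S.IsConvergent J r d)
    (hX : S.IsResponse univ J r d X) (hper : Periodic X.state (2 * h)) (hr : Antiperiodic r h)
    (hd : Antiperiodic d h) (hJ : ∀ t, t + h ∈ J ↔ t ∈ J) : Antiperiodic X.state h := by
  have hneg := hX.negShift hJ
  simp only [hr _, hd _, neg_neg] at hneg
  have hlim : Tendsto (fun t => X.state t + X.state (t + h)) atTop (𝓝 0) := by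
    have hneg_state (t : ℝ) : X.state t + X.state (t + h) = X.state t - (X.negShift h).state t :=
      (sub_neg_eq_add _ _).symm
    simp_rw [hneg_state]
    exact hconv X _ (hX.mono (subset_univ _)) (hneg.mono (subset_univ _))
  have hsum : Periodic (fun t => X.state t + X.state (t + h)) (2 * h) := fun t => by
    beta_reduce
    rw [hper t, add_right_comm, hper]
  exact fun t => eq_neg_of_add_eq_zero_right
    (eq_zero_of_periodic_of_tendsto hsum (by positivity) hlim t)

end ResetLoop

end Superposition

section AlgebraicLoop

namespace ResetLoop

/-- The state space of the closed loop. -/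
abbrev State (S : ResetLoop) : Type :=
  (Fin (S.Cr.k + 1) → ℝ) × (Fin S.C1.dim → ℝ) × (Fin S.C2.dim → ℝ) × (Fin S.C3.dim → ℝ) ×
    (Fin S.C4.dim → ℝ) × (Fin S.Cs.dim → ℝ) × (Fin S.P.dim → ℝ)

/-- The solution of the algebraic loop: the error, given the state, the reference and the
disturbance. -/
def errorMap (S : ResetLoop) : S.State × ℝ × ℝ → ℝ := fun ((xr, x1, x2, x3, x4, _, xP), r, d) =>
  (1 + (S.Cr.D + S.C2.D) * S.C3.D * S.P.D * S.C4.D * S.C1.D)⁻¹ *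
    (r - (S.C4.C ⬝ᵥ x4 + S.C4.D * (S.P.C ⬝ᵥ xP + S.P.D * (S.C3.C ⬝ᵥ x3 + S.C3.D *
      (S.Cr.C ⬝ᵥ xr + S.C2.C ⬝ᵥ x2 + (S.Cr.D + S.C2.D) * S.C1.C ⬝ᵥ x1) + d))))

variable {S : ResetLoop} {T J : Set ℝ} {r d : ℝ → ℝ} {X : S.Trajectory}

theorem IsResponse.error_eq_errorMap (hwp : S.WellPosed) (h : S.IsResponse T J r d X) {t : ℝ}
    (ht : t ∈ T) : X.e t = S.errorMap (X.state t, r t, d t) := by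
  rw [errorMap, eq_inv_mul_iff_mul_eq₀ hwp]
  have herr := h.err t ht
  simp only [h.c4.2.2 t ht, h.p.2.2 t ht, h.c3.2.2 t ht, h.cr.2.2 t ht, h.c2.2.2 t ht,
    h.c1.2.2 t ht] at herr
  simp only [Trajectory.state]
  linear_combination herr

theorem continuous_errorMap (S : ResetLoop) : Continuous S.errorMap := by
  unfold errorMap
  fun_prop

theorem errorMap_neg (S : ResetLoop) (v : S.State × ℝ × ℝ) : S.errorMap (-v) = -S.errorMap v := by
  simp only [errorMap, dotProduct_neg]
  ring

end ResetLoop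

end AlgebraicLoop

section HalfWaveResponse

namespace ResetLoop

/-- A half-wave symmetric response to half-wave symmetric inputs, with resets every half period
from `a` on. -/
structure IsHalfWaveResponse (S : ResetLoop) (ω a : ℝ) (J : Set ℝ) (r d : ℝ → ℝ)
    (X : S.Trajectory) : Prop where
  response : S.IsResponse univ J r d X
  antiperiodic : Antiperiodic X.state (π / ω)
  isResetCycle : IsResetCycle ω a J
  isHalfWave_r : IsHalfWave ω a r
  isHalfWave_d : IsHalfWave ω a d

namespace IsHalfWaveResponse

variable {S : ResetLoop} {ω a : ℝ} {J : Set ℝ} {r d : ℝ → ℝ} {X : S.Trajectory} {n : ℕ}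

section Antiperiodic

variable (h : S.IsHalfWaveResponse ω a J r d X)
include h

theorem antiperiodic_xr : Antiperiodic X.xr (π / ω) :=
  fun t => congrArg (·.1) (h.antiperiodic t)

theorem antiperiodic_x1 : Antiperiodic X.x1 (π / ω) :=
  fun t => congrArg (·.2.1) (h.antiperiodic t)

theorem antiperiodic_x2 : Antiperiodic X.x2 (π / ω) :=
  fun t => congrArg (·.2.2.1) (h.antiperiodic t)

theorem antiperiodic_x3 : Antiperiodic X.x3 (π / ω) :=
  fun t => congrArg (·.2.2.2.1) (h.antiperiodic t)

theorem antiperiodic_x4 : Antiperiodic X.x4 (π / ω) :=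
  fun t => congrArg (·.2.2.2.2.1) (h.antiperiodic t)

theorem antiperiodic_xs : Antiperiodic X.xs (π / ω) :=
  fun t => congrArg (·.2.2.2.2.2.1) (h.antiperiodic t)

theorem antiperiodic_xP : Antiperiodic X.xP (π / ω) :=
  fun t => congrArg (·.2.2.2.2.2.2) (h.antiperiodic t)

theorem isHalfWave_state : IsHalfWave ω a X.state :=
  (h.response.cr.isHalfWave_state h.antiperiodic_xr h.isResetCycle).prodMk <|
    (h.response.c1.isHalfWave_state h.antiperiodic_x1 a).prodMk <|
    (h.response.c2.isHalfWave_state h.antiperiodic_x2 a).prodMk <|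
    (h.response.c3.isHalfWave_state h.antiperiodic_x3 a).prodMk <|
    (h.response.c4.isHalfWave_state h.antiperiodic_x4 a).prodMk <|
    (h.response.cs.isHalfWave_state h.antiperiodic_xs a).prodMk
    (h.response.p.isHalfWave_state h.antiperiodic_xP a)

variable (hwp : S.WellPosed)
include hwp

theorem isHalfWave_e : IsHalfWave ω a X.e := by
  rw [show X.e = _ from funext fun t => h.response.error_eq_errorMap hwp (mem_univ t)]
  exact (h.isHalfWave_state.prodMk (h.isHalfWave_r.prodMk h.isHalfWave_d)).comp
    S.continuous_errorMap S.errorMap_neg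

theorem isHalfWave_z : IsHalfWave ω a X.z :=
  h.response.c1.isHalfWave_output h.antiperiodic_x1 (h.isHalfWave_e hwp)

theorem isHalfWave_m : IsHalfWave ω a X.m :=
  h.response.cr.isHalfWave_output h.antiperiodic_xr h.isResetCycle (h.isHalfWave_z hwp)

theorem isHalfWave_a : IsHalfWave ω a X.a :=
  h.response.c2.isHalfWave_output h.antiperiodic_x2 (h.isHalfWave_z hwp)

theorem isHalfWave_u : IsHalfWave ω a X.u :=
  h.response.c3.isHalfWave_output h.antiperiodic_x3
    ((h.isHalfWave_m hwp).add (h.isHalfWave_a hwp))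

theorem isHalfWave_y : IsHalfWave ω a X.y :=
  h.response.p.isHalfWave_output h.antiperiodic_xP ((h.isHalfWave_u hwp).add h.isHalfWave_d)

theorem isHalfWave_f : IsHalfWave ω a X.f :=
  h.response.c4.isHalfWave_output h.antiperiodic_x4 (h.isHalfWave_y hwp)

end Antiperiodic

variable (h : S.IsHalfWaveResponse ω a J r d X) (hwp : S.WellPosed) (hω : 0 < ω)
include h hwp hω

theorem harmonicCoeff_z (hn : Odd n) (hC1 : (pencil S.C1.A (n * ω)).det ≠ 0) :
    harmonicCoeff ω n X.z = S.C1.freq (n * ω) * harmonicCoeff ω n X.e :=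
  h.response.c1.harmonicCoeff_output h.antiperiodic_x1 (h.isHalfWave_e hwp) h.isResetCycle hω hn hC1

theorem harmonicCoeff_zs (hn : Odd n) (hCs : (pencil S.Cs.A (n * ω)).det ≠ 0) :
    harmonicCoeff ω n X.zs = S.Cs.freq (n * ω) * harmonicCoeff ω n X.z :=
  h.response.cs.harmonicCoeff_output h.antiperiodic_xs (h.isHalfWave_z hwp) h.isResetCycle hω hn hCs

theorem harmonicCoeff_e_add_f (n : ℕ) :
    harmonicCoeff ω n X.e + harmonicCoeff ω n X.f = harmonicCoeff ω n r := by
  rw [← (h.isHalfWave_e hwp).harmonicCoeff_add (h.isHalfWave_f hwp) hω]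
  congr 1
  funext t
  rw [h.response.err t (mem_univ t), sub_add_cancel]

theorem harmonicCoeff_f (hfreq : S.FreqDefined ω) (hn : Odd n) :
    harmonicCoeff ω n X.f = S.C4.freq (n * ω) * (S.P.freq (n * ω) *
      (S.C3.freq (n * ω) * (harmonicCoeff ω n X.m + S.C2.freq (n * ω) * harmonicCoeff ω n X.z) +
        harmonicCoeff ω n d)) := by
  have hpole (G : LTI) (hG : G ∈ [S.Cr.base, S.C1, S.C2, S.C3, S.C4, S.Cs, S.P]) :=
    hfreq n hn G hG
  rw [h.response.c4.harmonicCoeff_output h.antiperiodic_x4 (h.isHalfWave_y hwp) h.isResetCycle hω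
      hn (hpole S.C4 (by simp)),
    h.response.p.harmonicCoeff_output h.antiperiodic_xP ((h.isHalfWave_u hwp).add h.isHalfWave_d)
      h.isResetCycle hω hn (hpole S.P (by simp)),
    (h.isHalfWave_u hwp).harmonicCoeff_add h.isHalfWave_d hω,
    h.response.c3.harmonicCoeff_output h.antiperiodic_x3
      ((h.isHalfWave_m hwp).add (h.isHalfWave_a hwp)) h.isResetCycle hω hn (hpole S.C3 (by simp)),
    (h.isHalfWave_m hwp).harmonicCoeff_add (h.isHalfWave_a hwp) hω,
    h.response.c2.harmonicCoeff_output h.antiperiodic_x2 (h.isHalfWave_z hwp) h.isResetCycle hω hn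
      (hpole S.C2 (by simp))]

theorem harmonicCoeff_e_mul_one_add_Ll (hfreq : S.FreqDefined ω) (hn : Odd n) :
    harmonicCoeff ω n X.e * (1 + S.Ll (n * ω)) = harmonicCoeff ω n r -
      S.C4.freq (n * ω) * S.P.freq (n * ω) * (S.C3.freq (n * ω) *
        (2 * (S.Cr.Δx (n * ω) ⬝ᵥ fun i => (((S.Cr.Aρ - 1) *ᵥ X.xr a) i : ℂ)) / (n * π) *
          exp (-(I * n * ω * a))) + harmonicCoeff ω n d) := by
  have hm := h.response.cr.harmonicCoeff_output h.antiperiodic_xr h.isResetCycle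
    (h.isHalfWave_z hwp) hω hn (hfreq n hn S.Cr.base (by simp))
  have hsum := h.harmonicCoeff_e_add_f hwp hω n
  rw [h.harmonicCoeff_f hwp hω hfreq hn, hm,
    h.harmonicCoeff_z hwp hω hn (hfreq n hn S.C1 (by simp))] at hsum
  rw [Ll]
  linear_combination hsum

end IsHalfWaveResponse

end ResetLoop

end HalfWaveResponse

section Oscillation

/-- The sinusoid `Re (c exp (j ν t))` of frequency `ν` with complex amplitude `c`. -/
def phasor (ν : ℝ) (c : ℂ) (t : ℝ) : ℝ := (c * exp (I * ν * t)).re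

theorem phasor_add (ν : ℝ) (c c' : ℂ) (t : ℝ) :
    phasor ν (c + c') t = phasor ν c t + phasor ν c' t := by
  simp only [phasor, add_mul, add_re]

theorem phasor_ofReal_mul (ν r : ℝ) (c : ℂ) (t : ℝ) : phasor ν (r * c) t = r * phasor ν c t := by
  rw [phasor, mul_assoc, re_ofReal_mul, phasor]

theorem phasor_neg (ν : ℝ) (c : ℂ) (t : ℝ) : phasor ν (-c) t = -phasor ν c t := by
  rw [phasor, neg_mul, neg_re, phasor]

theorem phasor_dotProduct_mul {d : ℕ} (ν : ℝ) (C : Fin d → ℝ) (w : Fin d → ℂ) (c : ℂ) (t : ℝ) :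
    phasor ν (((fun i => (C i : ℂ)) ⬝ᵥ w) * c) t = C ⬝ᵥ fun i => phasor ν (w i * c) t := by
  simp only [dotProduct, ← phasor_ofReal_mul]
  simp only [phasor, Finset.sum_mul, re_sum, mul_assoc]

theorem hasDerivAt_phasor (ν : ℝ) (c : ℂ) (t : ℝ) :
    HasDerivAt (phasor ν c) (phasor ν (I * ν * c) t) t := by
  have hexp : HasDerivAt (fun t : ℝ => exp (I * ν * t)) (exp (I * ν * t) * (I * ν * 1)) t :=
    (((hasDerivAt_id (t : ℂ)).const_mul (I * (ν : ℂ))).cexp).comp_ofReal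
  refine (reCLM.hasFDerivAt.comp_hasDerivAt t (hexp.const_mul c)).congr_deriv ?_
  simp only [phasor, reCLM_apply]
  ring_nf

theorem phasor_antiperiodic {ω : ℝ} (hω : ω ≠ 0) {n : ℕ} (hn : Odd n) (c : ℂ) :
    Antiperiodic (phasor (n * ω) c) (π / ω) := fun t => by
  have hω' : (ω : ℂ) ≠ 0 := ofReal_ne_zero.2 hω
  have hexp : I * (n * ω : ℝ) * (t + π / ω : ℝ) = I * (n * ω : ℝ) * t + n * (π * I) := by
    push_cast
    field_simp
  rw [phasor, hexp, exp_add, exp_nat_mul, exp_pi_mul_I, hn.neg_one_pow, mul_neg_one, mul_neg,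
    neg_re, phasor]

theorem eq_zero_of_phasor_eq_zero {ν : ℝ} (hν : ν ≠ 0) {c : ℂ} (h : ∀ t, phasor ν c t = 0) :
    c = 0 := by
  have hderiv : phasor ν (I * ν * c) 0 = 0 :=
    (hasDerivAt_phasor ν c 0).unique <| (hasDerivAt_const 0 (0 : ℝ)).congr_of_eventuallyEq <|
      .of_forall h
  refine Complex.ext (by simpa [phasor] using h 0) ?_
  simpa [phasor, hν] using hderiv

theorem exists_phasor_mul_eq_zero (ν : ℝ) (q : ℂ) (t : ℝ) :
    ∃ ε : ℂ, ε ≠ 0 ∧ phasor ν (q * ε) t = 0 := by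
  by_cases hq : q = 0
  · exact ⟨1, one_ne_zero, by simp [phasor, hq]⟩
  · refine ⟨I * starRingEnd ℂ (q * exp (I * ν * t)), by simp [hq], ?_⟩
    rw [phasor, mul_right_comm, mul_left_comm, mul_conj, I_mul_re, ofReal_im, neg_zero]

theorem IsResetCycle.eq_zero_of_antiperiodic {ω a t : ℝ} {J : Set ℝ} {f : ℝ → ℝ}
    (hJ : IsResetCycle ω a J) (hω : 0 < ω) (hf : Antiperiodic f (π / ω)) (hfa : f a = 0)
    (ht : t ∈ J) : f t = 0 := by
  have hpos : 0 < π / ω := by positivity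
  have hmem : toIcoMod hpos a t ∈ J := by
    have hper : Periodic (· ∈ J) (π / ω) := fun t => propext (hJ.add_mem_iff t)
    exact (hper.sub_zsmul_eq (toIcoDiv hpos a t)).mpr ht
  have hmod : toIcoMod hpos a t = a := by
    by_contra hne
    have hIco := toIcoMod_mem_Ico hpos a t
    exact hJ.notMem _ ⟨lt_of_le_of_ne hIco.1 (Ne.symm hne), hIco.2⟩ hmem
  rw [← toIcoMod_add_toIcoDiv_zsmul hpos a t, hmod, hf.add_zsmul_eq, hfa, smul_zero]

namespace LTI

/-- The state of the block under the sinusoidal input with complex amplitude `c`. -/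
def phasorState (G : LTI) (ν : ℝ) (c : ℂ) (t : ℝ) (i : Fin G.dim) : ℝ :=
  phasor ν (((pencil G.A ν)⁻¹ *ᵥ fun i => (G.B i : ℂ)) i * c) t

theorem phasorState_antiperiodic (G : LTI) {ω : ℝ} (hω : ω ≠ 0) {n : ℕ} (hn : Odd n) (c : ℂ) :
    Antiperiodic (G.phasorState (n * ω) c) (π / ω) :=
  fun t => funext fun _ => phasor_antiperiodic hω hn _ t

theorem responds_phasor (G : LTI) {ν : ℝ} (hdet : (pencil G.A ν).det ≠ 0) (J : Set ℝ) (c : ℂ) :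
    G.Responds univ J (phasor ν c) (G.phasorState ν c) (phasor ν (G.freq ν * c)) := by
  set w := (pencil G.A ν)⁻¹ *ᵥ fun i => (G.B i : ℂ) with hw
  have hw_eq (i : Fin G.dim) : I * ν * w i = (fun j => (G.A i j : ℂ)) ⬝ᵥ w + G.B i := by
    have hsolve : pencil G.A ν *ᵥ w = fun i => (G.B i : ℂ) := by
      rw [hw, mulVec_mulVec, mul_nonsing_inv _ hdet.isUnit, one_mulVec]
    rw [pencil, sub_mulVec, smul_mulVec, one_mulVec] at hsolve
    rw [← congrFun hsolve i]
    exact (add_sub_cancel _ _).symm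
  have hder (t : ℝ) : HasDerivAt (G.phasorState ν c)
      (G.A *ᵥ G.phasorState ν c t + phasor ν c t • G.B) t := by
    refine hasDerivAt_pi.2 fun i => (hasDerivAt_phasor ν (w i * c) t).congr_deriv ?_
    rw [← mul_assoc, hw_eq, add_mul, phasor_add, phasor_ofReal_mul, phasor_dotProduct_mul,
      mul_comm (G.B i)]
    rfl
  refine ⟨fun t _ => (hder t).continuousAt.continuousWithinAt, fun t _ => hder t, fun t _ => ?_⟩
  rw [freq, add_mul, phasor_add, phasor_ofReal_mul, phasor_dotProduct_mul]
  rfl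

end LTI

namespace ResetController

variable {R : ResetController}

theorem Aρ_sub_one_mulVec (R : ResetController) (v : Fin (R.k + 1) → ℝ) :
    (R.Aρ - 1) *ᵥ v = Pi.single 0 ((R.γ - 1) * v 0) := by
  ext i
  rw [sub_mulVec, one_mulVec, Aρ, Pi.sub_apply, mulVec_diagonal]
  refine Fin.cases ?_ (fun j => ?_) i
  · simp only [Fin.cons_zero, Pi.single_eq_same]
    ring
  · simp

theorem Aρ_mulVec_of_zero {v : Fin (R.k + 1) → ℝ} (hv : v 0 = 0) : R.Aρ *ᵥ v = v := by
  rw [← sub_eq_zero]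
  simpa [sub_mulVec, hv] using R.Aρ_sub_one_mulVec v

theorem responds_of_base {J : Set ℝ} {z m : ℝ → ℝ} {x : ℝ → Fin (R.k + 1) → ℝ}
    (h : R.base.Responds univ ∅ z x m) (hJ : ∀ t ∈ J, x t 0 = 0) : R.Responds univ J z x m := by
  have hder (t : ℝ) : HasDerivAt x (R.A *ᵥ x t + z t • R.B) t :=
    h.2.1 t ⟨mem_univ t, notMem_empty t⟩
  refine ⟨fun t _ => hder t, fun t ht => ⟨(hder t).continuousAt.continuousWithinAt, ?_⟩, h.2.2⟩
  rw [Aρ_mulVec_of_zero (hJ t ht.2)]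
  exact (hder t).continuousAt.continuousWithinAt

end ResetController

namespace ResetLoop

variable {S : ResetLoop} {J : Set ℝ} {r d : ℝ → ℝ} {X V : S.Trajectory}

/-- The oscillation of the base-linear loop in which the error has complex amplitude `ε`. It closes
the loop when `1 + L_l(ν) = 0`. -/
def phasorTrajectory (S : ResetLoop) (ν : ℝ) (ε : ℂ) : S.Trajectory :=
  let z := S.C1.freq ν * ε
  let ma := S.Cr.base.freq ν * z + S.C2.freq ν * z
  let u := S.C3.freq ν * ma
  let y := S.P.freq ν * u
  { xr := S.Cr.base.phasorState ν z
    x1 := S.C1.phasorState ν ε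
    x2 := S.C2.phasorState ν z
    x3 := S.C3.phasorState ν ma
    x4 := S.C4.phasorState ν y
    xs := S.Cs.phasorState ν z
    xP := S.P.phasorState ν u
    e := phasor ν ε
    z := phasor ν z
    zs := phasor ν (S.Cs.freq ν * z)
    m := phasor ν (S.Cr.base.freq ν * z)
    a := phasor ν (S.C2.freq ν * z)
    u := phasor ν u
    y := phasor ν y
    f := phasor ν (S.C4.freq ν * y) }

theorem isResponse_phasorTrajectory {ν : ℝ} {ε : ℂ} (hL : 1 + S.Ll ν = 0)
    (hdet : ∀ G ∈ [S.Cr.base, S.C1, S.C2, S.C3, S.C4, S.Cs, S.P], (pencil G.A ν).det ≠ 0)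
    (hJ : ∀ t ∈ J, phasor ν (S.Cr.Δl ν 0 * (S.C1.freq ν * ε)) t = 0) :
    S.IsResponse univ J (fun _ => 0) (fun _ => 0) (S.phasorTrajectory ν ε) where
  c1 := S.C1.responds_phasor (hdet _ (by simp)) J _
  cs := S.Cs.responds_phasor (hdet _ (by simp)) J _
  cr := ResetController.responds_of_base
    (S.Cr.base.responds_phasor (hdet S.Cr.base (by simp)) ∅ _) hJ
  c2 := S.C2.responds_phasor (hdet _ (by simp)) J _
  c3 := by
    simp only [phasorTrajectory, ← phasor_add]
    exact S.C3.responds_phasor (hdet _ (by simp)) J _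
  p := by
    simp only [add_zero]
    exact S.P.responds_phasor (hdet _ (by simp)) J _
  c4 := S.C4.responds_phasor (hdet _ (by simp)) J _
  err t _ := by
    rw [zero_sub]
    simp only [phasorTrajectory, ← phasor_neg]
    congr 1
    rw [Ll] at hL
    linear_combination ε * hL

theorem phasorTrajectory_state_antiperiodic (S : ResetLoop) {ω : ℝ} (hω : ω ≠ 0) {n : ℕ}
    (hn : Odd n) (ε : ℂ) : Antiperiodic (S.phasorTrajectory (n * ω) ε).state (π / ω) := fun t => by
  simp only [Trajectory.state, phasorTrajectory, (LTI.phasorState_antiperiodic _ hω hn _) t]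
  rfl

theorem IsConvergent.state_eq_zero {T : ℝ} (hT : 0 < T) (hconv : S.IsConvergent J r d)
    (hX : S.IsResponse univ J r d X) (hV : S.IsResponse univ J (fun _ => 0) (fun _ => 0) V)
    (hper : Periodic V.state T) (t : ℝ) : V.state t = 0 := by
  have hXV := hX.add hV
  simp only [add_zero] at hXV
  have hlim := hconv (X.add V) X (hXV.mono (subset_univ _)) (hX.mono (subset_univ _))
  have hdiff (t : ℝ) : (X.add V).state t - X.state t = V.state t :=
    add_sub_cancel_left (X.state t) (V.state t)
  simp only [hdiff] at hlim
  exact eq_zero_of_periodic_of_tendsto hper hT hlim t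

/-- If `1 + L_l(nω) = 0`, then the base-linear loop oscillates at the frequency `nω`. With the phase
for which the reset state vanishes at the reset instants, this oscillation does not notice the
resets and persists in the reset loop. -/
theorem IsConvergent.one_add_Ll_ne_zero {ω a : ℝ} {n : ℕ} (hconv : S.IsConvergent J r d)
    (hX : S.IsResponse univ J r d X) (hJ : IsResetCycle ω a J) (hwp : S.WellPosed) (hω : 0 < ω)
    (hfreq : S.FreqDefined ω) (hn : Odd n) : 1 + S.Ll (n * ω) ≠ 0 := by
  intro hL
  obtain ⟨ε, hε, hεa⟩ :=
    exists_phasor_mul_eq_zero (n * ω) (S.Cr.Δl (n * ω) 0 * S.C1.freq (n * ω)) a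
  rw [mul_assoc] at hεa
  have hV : S.IsResponse univ J (fun _ => 0) (fun _ => 0) (S.phasorTrajectory (n * ω) ε) :=
    isResponse_phasorTrajectory hL (hfreq n hn) fun t ht =>
      hJ.eq_zero_of_antiperiodic hω (phasor_antiperiodic hω.ne' hn _) hεa ht
  have hper := (S.phasorTrajectory_state_antiperiodic hω.ne' hn ε).periodic_two_mul
  have hν : (n * ω : ℝ) ≠ 0 := mul_ne_zero (Nat.cast_ne_zero.2 hn.pos.ne') hω.ne'
  refine hε (eq_zero_of_phasor_eq_zero hν fun t => ?_)
  have herror := hV.error_eq_errorMap hwp (mem_univ t)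
  rw [hconv.state_eq_zero (by positivity) hX hV hper t] at herror
  exact herror.trans (by simp [errorMap])

end ResetLoop

end Oscillation

section Asymptotics

open Asymptotics

variable {d : ℕ}

open scoped Matrix.Norms.Operator in
theorem pencil_inv_isBigO (A : Matrix (Fin d) (Fin d) ℝ) (i j : Fin d) :
    (fun ν : ℝ => (pencil A ν)⁻¹ i j) =O[atTop] fun ν => ν⁻¹ := by
  have haxis : Tendsto (fun ν : ℝ => I * (ν : ℂ)) atTop (Bornology.cobounded ℂ) := by
    rw [← tendsto_norm_atTop_iff_cobounded]
    simpa using tendsto_abs_atTop_atTop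
  have hresolvent := (spectrum.resolvent_isBigO_inv (𝕜 := ℂ) (A.map ofReal)).comp_tendsto haxis
  have hpencil : resolvent (A.map ofReal) ∘ (fun ν : ℝ => I * (ν : ℂ)) =
      fun ν => (pencil A ν)⁻¹ := by
    ext1 ν
    simp only [Function.comp, resolvent, pencil, nonsing_inv_eq_ringInverse,
      Algebra.algebraMap_eq_smul_one]
  rw [hpencil] at hresolvent
  let entry : Matrix (Fin d) (Fin d) ℂ →L[ℂ] ℂ := (entryLinearMap ℂ ℂ i j).toContinuousLinearMap
  refine ((entry.isBigO_comp (fun ν => (pencil A ν)⁻¹) atTop).trans hresolvent).trans ?_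
  exact .of_bound 1 (.of_forall fun ν => by simp)

theorem isBigO_dotProduct {α : Type*} {l : Filter α} {g : α → ℝ} {v : α → Fin d → ℂ}
    (h : ∀ i, (fun ν => v ν i) =O[l] g) (c : Fin d → ℂ) : (fun ν => v ν ⬝ᵥ c) =O[l] g := by
  simp only [dotProduct, mul_comm _ (c _)]
  exact .fun_sum fun i _ => (h i).const_mul_left (c i)

theorem pencil_inv_mulVec_isBigO (A : Matrix (Fin d) (Fin d) ℝ) (c : Fin d → ℂ) (i : Fin d) :
    (fun ν : ℝ => ((pencil A ν)⁻¹ *ᵥ c) i) =O[atTop] fun ν => ν⁻¹ :=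
  isBigO_dotProduct (pencil_inv_isBigO A i) c

theorem vecMul_pencil_inv_isBigO (A : Matrix (Fin d) (Fin d) ℝ) (c : Fin d → ℂ) (i : Fin d) :
    (fun ν : ℝ => (c ᵥ* (pencil A ν)⁻¹) i) =O[atTop] fun ν => ν⁻¹ := by
  simp only [vecMul, dotProduct_comm c]
  exact isBigO_dotProduct (pencil_inv_isBigO A · i) c

theorem LTI.tendsto_freq (G : LTI) : Tendsto G.freq atTop (𝓝 (G.D : ℂ)) := by
  have hzero : Tendsto (fun ν : ℝ => (fun i => (G.C i : ℂ)) ⬝ᵥ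
      ((pencil G.A ν)⁻¹ *ᵥ fun i => (G.B i : ℂ))) atTop (𝓝 0) := by
    simp_rw [dotProduct_comm (fun i => (G.C i : ℂ))]
    exact (isBigO_dotProduct (pencil_inv_mulVec_isBigO G.A _) _).trans_tendsto
      tendsto_inv_atTop_zero
  simpa only [zero_add] using! hzero.add_const (G.D : ℂ)

theorem ResetController.Δx_isBigO (R : ResetController) (i : Fin (R.k + 1)) :
    (fun ν => R.Δx ν i) =O[atTop] fun _ => (1 : ℝ) := by
  have hfactor : (fun ν : ℝ => I * (ν : ℂ)) =O[atTop] fun ν => ν :=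
    .of_bound 1 (.of_forall fun ν => by simp)
  refine (hfactor.mul (vecMul_pencil_inv_isBigO R.A (fun i => (R.C i : ℂ)) i)).trans ?_
  refine .of_bound 1 (.of_forall fun ν => ?_)
  rw [norm_mul, norm_inv, norm_one, mul_one]
  exact mul_inv_le_one

theorem norm_exp_I_mul_natCast_mul (n : ℕ) (θ : ℝ) : ‖exp (I * n * θ)‖ = 1 := by
  have harg : I * n * θ = ((n * θ : ℝ) : ℂ) * I := by
    push_cast
    ring
  rw [harg, norm_exp_ofReal_mul_I]

theorem tendsto_natCast_mul_atTop {ω : ℝ} (hω : 0 < ω) :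
    Tendsto (fun n : ℕ => (n : ℝ) * ω) atTop atTop :=
  tendsto_natCast_atTop_atTop.atTop_mul_const hω

namespace ResetLoop

variable (S : ResetLoop) {ω : ℝ}

theorem tendsto_Ll : Tendsto S.Ll atTop
    (𝓝 (((S.Cr.D + S.C2.D) * S.C3.D * S.P.D * S.C4.D * S.C1.D : ℝ) : ℂ)) := by
  push_cast
  exact ((((S.Cr.base.tendsto_freq.add S.C2.tendsto_freq).mul S.C3.tendsto_freq).mul
    S.P.tendsto_freq).mul S.C4.tendsto_freq).mul S.C1.tendsto_freq

theorem Cρ_isBigO (hω : 0 < ω) : S.Cρ ω =O[atTop] fun n : ℕ => (n : ℝ)⁻¹ := by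
  have hΔ : (fun n : ℕ => S.Cr.Δx (n * ω) ⬝ᵥ fun i => (S.Δq ω i : ℂ)) =O[atTop]
      fun _ => (1 : ℝ) :=
    (isBigO_dotProduct S.Cr.Δx_isBigO _).comp_tendsto (tendsto_natCast_mul_atTop hω)
  have hexp : (fun n : ℕ => exp (I * n * arg (S.Cs.freq ω))) =O[atTop] fun _ => (1 : ℝ) :=
    .of_bound 1 (.of_forall fun n => by rw [norm_exp_I_mul_natCast_mul, norm_one, mul_one])
  have hinv : (fun n : ℕ => ((n : ℂ) * π)⁻¹) =O[atTop] fun n : ℕ => (n : ℝ)⁻¹ :=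
    .of_bound π⁻¹ (.of_forall fun n => by simp [abs_of_pos Real.pi_pos])
  simpa only [Cρ, div_eq_mul_inv, one_mul] using! ((hΔ.const_mul_left 2).mul hexp).mul hinv

theorem Lρ_isBigO (hω : 0 < ω) : S.Lρ ω =O[atTop] fun n : ℕ => (n : ℝ)⁻¹ := by
  have hfreq (G : LTI) : (fun n : ℕ => G.freq (n * ω)) =O[atTop] fun _ => (1 : ℝ) :=
    (G.tendsto_freq.comp (tendsto_natCast_mul_atTop hω)).isBigO_one ℝ
  simpa only [Lρ, mul_one] using!
    ((((S.Cρ_isBigO hω).mul (hfreq S.C3)).mul (hfreq S.P)).mul (hfreq S.C4)).mul (hfreq S.C1)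

theorem Ψ_isBigO (hwp : S.WellPosed) (hω : 0 < ω) : S.Ψ ω =O[atTop] fun n : ℕ => (n : ℝ)⁻¹ := by
  have hinv : (fun n : ℕ => (1 + S.Ll (n * ω))⁻¹) =O[atTop] fun _ => (1 : ℝ) := by
    have hlim := (S.tendsto_Ll.comp (tendsto_natCast_mul_atTop hω)).const_add 1
    exact (hlim.inv₀ (by exact_mod_cast hwp)).isBigO_one ℝ
  simpa only [Ψ, div_eq_mul_inv, norm_inv, mul_one] using!
    (S.Lρ_isBigO hω).norm_left.mul hinv.norm_left

theorem summable_Ψ_mul_norm_Δl (hwp : S.WellPosed) (hω : 0 < ω) :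
    Summable fun n : ℕ => S.Ψ ω n * ‖S.Cr.Δl (n * ω) 0‖ := by
  have hΔ : (fun n : ℕ => S.Cr.Δl (n * ω) 0) =O[atTop] fun n : ℕ => ((n : ℝ) * ω)⁻¹ :=
    (pencil_inv_mulVec_isBigO S.Cr.A _ 0).comp_tendsto (tendsto_natCast_mul_atTop hω)
  have hsum : Summable fun n : ℕ => ω⁻¹ * ((n : ℝ) ^ 2)⁻¹ :=
    (Real.summable_nat_pow_inv.2 one_lt_two).mul_left _
  refine summable_of_isBigO_nat hsum
    (((S.Ψ_isBigO hwp hω).mul hΔ.norm_left).congr_right fun n => ?_)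
  rw [mul_inv, pow_two, mul_inv]
  ring

theorem Ψ_nonneg (ω : ℝ) (n : ℕ) : 0 ≤ S.Ψ ω n :=
  div_nonneg (norm_nonneg _) (norm_nonneg _)

theorem summable_ΓTerm (hwp : S.WellPosed) (hω : 0 < ω) : Summable (S.ΓTerm ω) := by
  have hinj : Injective fun k : ℕ => 2 * k + 3 := fun k l h => by simpa using h
  refine .of_norm_bounded ((S.summable_Ψ_mul_norm_Δl hwp hω).comp_injective hinj) fun k => ?_
  rw [ΓTerm, Δcn, if_neg (by omega), norm_mul, Real.norm_of_nonneg (S.Ψ_nonneg ω _), norm_neg,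
    norm_mul, norm_norm]
  refine mul_le_mul_of_nonneg_left ?_ (S.Ψ_nonneg ω _)
  exact mul_le_of_le_one_right (norm_nonneg _) (Real.abs_sin_le_one _)

end ResetLoop

end Asymptotics

section Polar

theorem norm_mul_exp_I_arg (w : ℂ) : ‖w‖ * exp (I * arg w) = w := by
  rw [mul_comm I, norm_mul_exp_arg_mul_I]

theorem exp_I_arg_mul {x y : ℂ} (hx : x ≠ 0) (hy : y ≠ 0) :
    exp (I * arg (x * y)) = exp (I * arg x) * exp (I * arg y) := by
  have hxy : (‖x * y‖ : ℂ) ≠ 0 := ofReal_ne_zero.2 (norm_ne_zero_iff.2 (mul_ne_zero hx hy))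
  apply mul_left_cancel₀ hxy
  rw [norm_mul_exp_I_arg, norm_mul, ofReal_mul, mul_mul_mul_comm, norm_mul_exp_I_arg,
    norm_mul_exp_I_arg]

theorem exp_I_natCast_arg_mul {x y : ℂ} (hx : x ≠ 0) (hy : y ≠ 0) (n : ℕ) :
    exp (I * n * arg (x * y)) = exp (I * n * arg x) * exp (I * n * arg y) := by
  have hpow (w : ℂ) : exp (I * n * arg w) = exp (I * arg w) ^ n := by
    rw [← exp_nat_mul]
    ring_nf
  rw [hpow, hpow, hpow, exp_I_arg_mul hx hy, mul_pow]

/-- The complex number `|w| exp (j n ∠w)`, the factor by which the phase of the first harmonic `w`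
of a signal enters the `n`-th harmonics that it generates. -/
def phaseMul (n : ℕ) (w : ℂ) : ℂ := ‖w‖ * exp (I * n * arg w)

theorem phaseMul_mul (n : ℕ) (x y : ℂ) : phaseMul n (x * y) = phaseMul n x * phaseMul n y := by
  rcases eq_or_ne x 0 with rfl | hx
  · simp [phaseMul]
  rcases eq_or_ne y 0 with rfl | hy
  · simp [phaseMul]
  rw [phaseMul, exp_I_natCast_arg_mul hx hy, norm_mul, ofReal_mul, mul_mul_mul_comm]
  rfl

theorem phaseMul_ofReal (n : ℕ) {r : ℝ} (hr : 0 ≤ r) : phaseMul n r = r := by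
  simp [phaseMul, arg_ofReal_of_nonneg hr, abs_of_nonneg hr]

theorem phaseMul_one (w : ℂ) : phaseMul 1 w = w := by
  simpa [phaseMul] using norm_mul_exp_I_arg w

theorem phaseMul_eq_mul_exp (n : ℕ) (w : ℂ) : phaseMul n w = w * exp (I * (n - 1) * arg w) := by
  have harg : I * n * arg w = I * arg w + I * (n - 1) * arg w := by ring
  rw [phaseMul, harg, exp_add, ← mul_assoc, norm_mul_exp_I_arg]

theorem norm_phaseMul (n : ℕ) (w : ℂ) : ‖phaseMul n w‖ = ‖w‖ := by
  rw [phaseMul, norm_mul, norm_exp_I_mul_natCast_mul, mul_one, norm_real, norm_norm]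

theorem norm_mul_exp_arg_mul {x y : ℂ} (hx : x ≠ 0) (hy : y ≠ 0) (n : ℕ) :
    ‖y‖ * exp (I * n * arg (x * y)) = exp (I * n * arg x) * phaseMul n y := by
  rw [exp_I_natCast_arg_mul hx hy, phaseMul]
  ring

theorem phaseMul_mul_exp_neg_arg_mul {x y : ℂ} (hx : x ≠ 0) (hy : y ≠ 0) (n : ℕ) :
    phaseMul n y * exp (-(I * n * arg (x * y))) = ‖y‖ * exp (-(I * (n * arg x : ℝ))) := by
  have harg : I * (n * arg x : ℝ) = I * n * arg x := by
    push_cast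
    ring
  rw [exp_neg, exp_neg, harg, ← div_eq_mul_inv, ← div_eq_mul_inv,
    div_eq_div_iff (exp_ne_zero _) (exp_ne_zero _), norm_mul_exp_arg_mul hx hy, mul_comm]

theorem im_mul_exp_neg (x : ℂ) (θ : ℝ) :
    (x * exp (-(I * θ))).im = ‖x‖ * Real.sin (arg x - θ) := by
  have harg : I * arg x + -(I * θ) = ((arg x - θ : ℝ) : ℂ) * I := by
    push_cast
    ring
  conv_lhs => rw [← norm_mul_exp_I_arg x]
  rw [mul_assoc, ← exp_add, harg, im_ofReal_mul, exp_ofReal_mul_I_im]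

theorem im_mul_div_mul_exp_neg (x y w : ℂ) (θ : ℝ) :
    (x * (y / w) * exp (-(I * θ))).im =
      ‖y‖ / ‖w‖ * (‖x‖ * Real.sin (arg x + arg y - arg w - θ)) := by
  have harg : ((arg x + arg y - arg w - θ : ℝ) : ℂ) * I =
      I * arg x + I * arg y + -(I * arg w) + -(I * θ) := by
    push_cast
    ring
  have hpolar : x * (y / w) * exp (-(I * θ)) = ((‖y‖ / ‖w‖ * ‖x‖ : ℝ) : ℂ) *
      exp (((arg x + arg y - arg w - θ : ℝ) : ℂ) * I) := by
    conv_lhs => rw [← norm_mul_exp_I_arg x, ← norm_mul_exp_I_arg y, ← norm_mul_exp_I_arg w]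
    rw [harg, exp_add, exp_add, exp_add, exp_neg (I * arg w)]
    push_cast
    ring
  rw [hpolar, im_ofReal_mul, exp_ofReal_mul_I_im, mul_assoc]

end Polar

section TwoResetSteadyState

namespace ResetLoop

variable {S : ResetLoop} {ω : ℝ} {X : S.Trajectory}

/-- The instant `-∠Z_s / ω` at which the first harmonic `z_s¹` crosses zero upwards. -/
def firstReset (ω : ℝ) (X : S.Trajectory) : ℝ := -arg (harmonicCoeff ω 1 X.zs) / ω

theorem mul_firstReset (hω : ω ≠ 0) (X : S.Trajectory) :
    ω * firstReset ω X = -arg (harmonicCoeff ω 1 X.zs) :=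
  mul_div_cancel₀ _ hω

theorem exp_I_mul_firstReset (hω : ω ≠ 0) (X : S.Trajectory) (n : ℕ) :
    exp (I * n * ω * firstReset ω X) = exp (-(I * n * arg (harmonicCoeff ω 1 X.zs))) := by
  have hcast : (ω : ℂ) * firstReset ω X = -arg (harmonicCoeff ω 1 X.zs) := by
    exact_mod_cast mul_firstReset hω X
  rw [mul_assoc _ (ω : ℂ), hcast, mul_neg]

theorem mem_resetInstants (hZ : harmonicCoeff ω 1 X.zs ≠ 0) (t : ℝ) :
    t ∈ resetInstants ω X ↔ Real.sin (ω * t + arg (harmonicCoeff ω 1 X.zs)) = 0 := by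
  simp [resetInstants, harmonicSignal, hZ]

theorem isResetCycle_resetInstants (hω : 0 < ω) (hZ : harmonicCoeff ω 1 X.zs ≠ 0) :
    IsResetCycle ω (firstReset ω X) (resetInstants ω X) where
  mem := by rw [mem_resetInstants hZ, mul_firstReset hω.ne', neg_add_cancel, Real.sin_zero]
  notMem t ht := by
    have hlower : ω * firstReset ω X < ω * t := mul_lt_mul_of_pos_left ht.1 hω
    have hupper : ω * t < ω * (firstReset ω X + π / ω) := mul_lt_mul_of_pos_left ht.2 hω
    rw [mul_add, mul_div_cancel₀ _ hω.ne'] at hupper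
    rw [mul_firstReset hω.ne'] at hlower hupper
    rw [mem_resetInstants hZ]
    exact (Real.sin_pos_of_pos_of_lt_pi (by linarith) (by linarith)).ne'
  add_mem_iff t := by
    rw [mem_resetInstants hZ, mem_resetInstants hZ, mul_add, mul_div_cancel₀ _ hω.ne',
      add_right_comm, Real.sin_add_pi, neg_eq_zero]

theorem IsTwoResetSteadyState.isHalfWaveResponse {r d : ℝ → ℝ}
    (hX : S.IsTwoResetSteadyState ω r d X) (hω : 0 < ω)
    (hconv : S.IsConvergent (resetInstants ω X) r d)
    (hr : IsHalfWave ω (firstReset ω X) r) (hd : IsHalfWave ω (firstReset ω X) d) :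
    S.IsHalfWaveResponse ω (firstReset ω X) (resetInstants ω X) r d X where
  response := hX.response
  antiperiodic := hconv.state_antiperiodic (div_pos Real.pi_pos hω) hX.response
    (mul_div_assoc 2 π ω ▸ hX.periodic) hr.antiperiodic hd.antiperiodic
    (isResetCycle_resetInstants hω hX.trigger_ne_zero).add_mem_iff
  isResetCycle := isResetCycle_resetInstants hω hX.trigger_ne_zero
  isHalfWave_r := hr
  isHalfWave_d := hd

theorem jump_eq_smul_Δq (S : ResetLoop) (hE : (1 + S.Cr.expHalf ω).det ≠ 0)
    (hdet : (S.Cr.Aρ * S.Cr.expHalf ω + 1).det ≠ 0) (hΔ : S.Δc ω 0 ≠ 0)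
    (ξ : Fin (S.Cr.k + 1) → ℝ) :
    (S.Cr.Aρ - 1) *ᵥ ξ = (S.Cr.baseState ω ξ 0 / S.Δc ω 0) • S.Δq ω := by
  have hparallel : (S.Cr.Aρ - 1) *ᵥ S.Cr.baseState ω ξ =
      (S.Cr.baseState ω ξ 0 / S.Δc ω 0) • ((S.Cr.Aρ - 1) *ᵥ S.Δc ω) := by
    rw [S.Cr.Aρ_sub_one_mulVec, S.Cr.Aρ_sub_one_mulVec, ← Pi.single_smul, smul_eq_mul,
      mul_left_comm, div_mul_cancel₀ _ hΔ]
  rw [S.Cr.jump_eq_mulVec_baseState hE hdet, ← mulVec_mulVec, hparallel, mulVec_smul,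
    mulVec_mulVec, Δq]

/-- The ratio of the jump of the reset controller at `firstReset ω X` to the one that the first
harmonic of its input alone would cause. It turns out to be `Γ(ω)`. -/
def jumpGain (ω : ℝ) (X : S.Trajectory) : ℝ :=
  S.Cr.baseState ω (X.xr (firstReset ω X)) 0 / (‖harmonicCoeff ω 1 X.z‖ * S.Δc ω 0)

namespace IsHalfWaveResponse

variable {J : Set ℝ} {r d : ℝ → ℝ} {n : ℕ}
  (h : S.IsHalfWaveResponse ω (firstReset ω X) J r d X) (hω : 0 < ω) (hwp : S.WellPosed)
  (hfreq : S.FreqDefined ω) (hZs : harmonicCoeff ω 1 X.zs ≠ 0)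

section Trigger

include h hω hwp hfreq

theorem harmonicCoeff_one_zs :
    harmonicCoeff ω 1 X.zs = S.Cs.freq ω * harmonicCoeff ω 1 X.z := by
  simpa only [Nat.cast_one, one_mul] using
    h.harmonicCoeff_zs hwp hω odd_one (hfreq 1 odd_one S.Cs (by simp))

include hZs

theorem Cs_freq_ne_zero : S.Cs.freq ω ≠ 0 :=
  left_ne_zero_of_mul (h.harmonicCoeff_one_zs hω hwp hfreq ▸ hZs)

theorem harmonicCoeff_one_z_ne_zero : harmonicCoeff ω 1 X.z ≠ 0 :=
  right_ne_zero_of_mul (h.harmonicCoeff_one_zs hω hwp hfreq ▸ hZs)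

theorem norm_mul_exp_neg_firstReset (n : ℕ) :
    ‖harmonicCoeff ω 1 X.z‖ * exp (-(I * n * ω * firstReset ω X)) =
      exp (I * n * arg (S.Cs.freq ω)) * phaseMul n (harmonicCoeff ω 1 X.z) := by
  rw [exp_neg, exp_I_mul_firstReset hω.ne', exp_neg, inv_inv,
    h.harmonicCoeff_one_zs hω hwp hfreq, norm_mul_exp_arg_mul
    (h.Cs_freq_ne_zero hω hwp hfreq hZs) (h.harmonicCoeff_one_z_ne_zero hω hwp hfreq hZs)]

theorem phaseMul_mul_exp_firstReset (n : ℕ) :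
    phaseMul n (harmonicCoeff ω 1 X.z) * exp (I * n * ω * firstReset ω X) =
      ‖harmonicCoeff ω 1 X.z‖ * exp (-(I * (n * arg (S.Cs.freq ω) : ℝ))) := by
  rw [exp_I_mul_firstReset hω.ne', h.harmonicCoeff_one_zs hω hwp hfreq,
    phaseMul_mul_exp_neg_arg_mul (h.Cs_freq_ne_zero hω hwp hfreq hZs)
      (h.harmonicCoeff_one_z_ne_zero hω hwp hfreq hZs)]

theorem jumpGain_mul (hΔ : S.Δc ω 0 ≠ 0) :
    jumpGain ω X * (‖harmonicCoeff ω 1 X.z‖ * S.Δc ω 0) =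
      S.Cr.baseState ω (X.xr (firstReset ω X)) 0 :=
  div_mul_cancel₀ _ <| mul_ne_zero
    (norm_ne_zero_iff.2 (h.harmonicCoeff_one_z_ne_zero hω hwp hfreq hZs)) hΔ

theorem jump_eq_jumpGain_smul (hdet : (S.Cr.Aρ * S.Cr.expHalf ω + 1).det ≠ 0)
    (hΔ : S.Δc ω 0 ≠ 0) :
    (S.Cr.Aρ - 1) *ᵥ X.xr (firstReset ω X) =
      (jumpGain ω X * ‖harmonicCoeff ω 1 X.z‖) • S.Δq ω := by
  have hE : (1 + S.Cr.expHalf ω).det ≠ 0 :=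
    det_one_add_exp_ne_zero S.Cr.A hω fun n hn => hfreq n hn S.Cr.base (by simp)
  rw [S.jump_eq_smul_Δq hE hdet hΔ, ← h.jumpGain_mul hω hwp hfreq hZs hΔ, ← mul_assoc,
    mul_div_cancel_right₀ _ hΔ]

theorem harmonic_balance (hdet : (S.Cr.Aρ * S.Cr.expHalf ω + 1).det ≠ 0) (hΔ : S.Δc ω 0 ≠ 0)
    (hn : Odd n) :
    harmonicCoeff ω n X.e * (1 + S.Ll (n * ω)) = harmonicCoeff ω n r -
      S.C4.freq (n * ω) * S.P.freq (n * ω) * (S.C3.freq (n * ω) *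
        (jumpGain ω X * S.Cρ ω n * phaseMul n (harmonicCoeff ω 1 X.z)) +
          harmonicCoeff ω n d) := by
  have hjump : (fun i => (((S.Cr.Aρ - 1) *ᵥ X.xr (firstReset ω X)) i : ℂ)) =
      (jumpGain ω X * ‖harmonicCoeff ω 1 X.z‖ : ℂ) • fun i => (S.Δq ω i : ℂ) := by
    ext i
    simp [h.jump_eq_jumpGain_smul hω hwp hfreq hZs hdet hΔ]
  rw [h.harmonicCoeff_e_mul_one_add_Ll hwp hω hfreq hn, hjump, dotProduct_smul, smul_eq_mul, Cρ]
  linear_combination (-(S.C4.freq (n * ω) * S.P.freq (n * ω) * S.C3.freq (n * ω) * jumpGain ω X *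
    (2 * (S.Cr.Δx (n * ω) ⬝ᵥ fun i => (S.Δq ω i : ℂ)) / (n * π)))) *
      h.norm_mul_exp_neg_firstReset hω hwp hfreq hZs n

end Trigger

section SinusoidalInput

variable (hdet : (S.Cr.Aρ * S.Cr.expHalf ω + 1).det ≠ 0) (hΔ : S.Δc ω 0 ≠ 0)
  (hLl : ∀ n : ℕ, Odd n → 1 + S.Ll (n * ω) ≠ 0)
  (hr : ∀ n : ℕ, Odd n → n ≠ 1 → harmonicCoeff ω n r = 0)
  (hd : ∀ n : ℕ, Odd n → n ≠ 1 → harmonicCoeff ω n d = 0)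
include h hω hwp hfreq hZs hdet hΔ hLl hr hd

theorem harmonicCoeff_z_of_ne_one (hn : Odd n) (hn1 : n ≠ 1) :
    harmonicCoeff ω n X.z = (-jumpGain ω X : ℝ) * (S.Lρ ω n / (1 + S.Ll (n * ω))) *
      phaseMul n (harmonicCoeff ω 1 X.z) := by
  have hbal := h.harmonic_balance hω hwp hfreq hZs hdet hΔ hn
  rw [hr n hn hn1, hd n hn hn1] at hbal
  have hLn := hLl n hn
  rw [h.harmonicCoeff_z hwp hω hn (hfreq n hn S.C1 (by simp)), Lρ]
  push_cast
  field_simp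
  linear_combination S.C1.freq (n * ω) * hbal

theorem summable_Δl_mul_harmonicCoeff_z :
    Summable fun k : ℕ => S.Cr.Δl ((2 * k + 1 : ℕ) * ω) 0 * harmonicCoeff ω (2 * k + 1) X.z := by
  have hinj : Injective fun k : ℕ => 2 * (k + 1) + 1 := fun k l hkl => by simpa using hkl
  have hbound := ((S.summable_Ψ_mul_norm_Δl hwp hω).comp_injective hinj).mul_left
    (|jumpGain ω X| * ‖harmonicCoeff ω 1 X.z‖)
  rw [← summable_nat_add_iff 1]
  refine .of_norm_bounded hbound fun k => le_of_eq ?_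
  rw [h.harmonicCoeff_z_of_ne_one hω hwp hfreq hZs hdet hΔ hLl hr hd ⟨k + 1, rfl⟩ (by omega),
    norm_mul, norm_mul, norm_mul, norm_real, norm_neg, norm_div, norm_phaseMul, Real.norm_eq_abs]
  simp only [Function.comp_apply, Ψ]
  ring

theorem im_Δl_mul_harmonicCoeff_z (hn : Odd n) (hn1 : n ≠ 1) :
    (S.Cr.Δl (n * ω) 0 * harmonicCoeff ω n X.z * exp (I * n * ω * firstReset ω X)).im =
      jumpGain ω X * ‖harmonicCoeff ω 1 X.z‖ * (S.Ψ ω n * S.Δcn ω n) := by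
  have hpolar : S.Cr.Δl (n * ω) 0 * harmonicCoeff ω n X.z * exp (I * n * ω * firstReset ω X) =
      ((-jumpGain ω X * ‖harmonicCoeff ω 1 X.z‖ : ℝ) : ℂ) * (S.Cr.Δl (n * ω) 0 *
        (S.Lρ ω n / (1 + S.Ll (n * ω))) * exp (-(I * (n * arg (S.Cs.freq ω) : ℝ)))) := by
    rw [h.harmonicCoeff_z_of_ne_one hω hwp hfreq hZs hdet hΔ hLl hr hd hn hn1, ofReal_mul]
    linear_combination (S.Cr.Δl (n * ω) 0 * (-jumpGain ω X : ℝ) *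
      (S.Lρ ω n / (1 + S.Ll (n * ω)))) * h.phaseMul_mul_exp_firstReset hω hwp hfreq hZs n
  rw [hpolar, im_ofReal_mul, im_mul_div_mul_exp_neg, Δcn, if_neg hn1, Ψ]
  ring

omit hdet hΔ hLl hr hd in
theorem im_Δl_mul_harmonicCoeff_one_z :
    (S.Cr.Δl ω 0 * harmonicCoeff ω 1 X.z * exp (I * ω * firstReset ω X)).im =
      ‖harmonicCoeff ω 1 X.z‖ * S.Δc ω 0 := by
  have hphase := h.phaseMul_mul_exp_firstReset hω hwp hfreq hZs 1
  simp only [phaseMul_one, Nat.cast_one, mul_one, one_mul] at hphase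
  rw [mul_assoc, hphase, mul_left_comm, im_ofReal_mul, im_mul_exp_neg, Δc]

theorem baseState_firstReset_eq :
    S.Cr.baseState ω (X.xr (firstReset ω X)) 0 = ‖harmonicCoeff ω 1 X.z‖ *
      (S.Δc ω 0 + jumpGain ω X * ∑' k, S.ΓTerm ω k) := by
  have hsum := h.response.cr.hasSum_baseState h.antiperiodic_xr h.isResetCycle (h.isHalfWave_z hwp)
    hω (fun n hn => hfreq n hn S.Cr.base (by simp)) 0
    (h.summable_Δl_mul_harmonicCoeff_z hω hwp hfreq hZs hdet hΔ hLl hr hd)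
  have hfirst := h.im_Δl_mul_harmonicCoeff_one_z hω hwp hfreq hZs
  have hrest (k : ℕ) := h.im_Δl_mul_harmonicCoeff_z hω hwp hfreq hZs hdet hΔ hLl hr hd
    (n := 2 * (k + 1) + 1) ⟨k + 1, rfl⟩ (by omega)
  rw [← hasSum_nat_add_iff' 1] at hsum
  simp only [hrest, Finset.sum_range_one, mul_zero, zero_add, Nat.cast_one, one_mul, mul_one,
    hfirst] at hsum
  have htail := ((S.summable_ΓTerm hwp hω).hasSum.mul_left
    (jumpGain ω X * ‖harmonicCoeff ω 1 X.z‖)).unique hsum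
  linear_combination -htail

theorem jumpGain_mul_ΓDen : jumpGain ω X * S.ΓDen ω = 1 := by
  have hZ := norm_ne_zero_iff.2 (h.harmonicCoeff_one_z_ne_zero hω hwp hfreq hZs)
  have hbase := h.baseState_firstReset_eq hω hwp hfreq hZs hdet hΔ hLl hr hd
  rw [← h.jumpGain_mul hω hwp hfreq hZs hΔ, mul_left_comm] at hbase
  have hgain := mul_left_cancel₀ hZ hbase
  rw [ΓDen, Δcn, if_pos rfl]
  field_simp
  linear_combination hgain

end SinusoidalInput

end IsHalfWaveResponse

end ResetLoop

end TwoResetSteadyState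

section ProcessSensitivity

namespace ResetLoop

variable {S : ResetLoop} {ω D : ℝ} {X : S.Trajectory} {n : ℕ}

theorem Lo_eq (S : ResetLoop) (ω : ℝ) : S.Lo ω = S.Ll ω + S.Γ ω * S.Lρ ω 1 := by
  simp only [Lo, L, Ll, Lρ, if_true, Nat.cast_one, one_mul]
  ring

theorem PS_eq_div (hω : ω ≠ 0) (D : ℝ) (X : S.Trajectory) (hn : n ≠ 0) :
    PS ω D X n = harmonicCoeff ω n X.e / D := by
  rw [PS, harmonicCoeff_const_mul_sin hω D hn, if_pos rfl]

namespace IsTwoResetSteadyState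

variable (hX : S.IsTwoResetSteadyState ω (fun _ => 0) (fun t => D * Real.sin (ω * t)) X)
  (hω : 0 < ω)
  (hconv : S.IsConvergent (resetInstants ω X) (fun _ => 0) fun t => D * Real.sin (ω * t))
  (hwp : S.WellPosed)
include hX hω hconv

theorem isHalfWaveResponse_sin : S.IsHalfWaveResponse ω (firstReset ω X) (resetInstants ω X)
    (fun _ => 0) (fun t => D * Real.sin (ω * t)) X :=
  hX.isHalfWaveResponse hω hconv (by simpa using isHalfWave_const_mul_sin hω.ne' _ 0)
    (isHalfWave_const_mul_sin hω.ne' _ D)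

include hwp

theorem harmonicCoeff_e_of_even (hn : Even n) : harmonicCoeff ω n X.e = 0 :=
  ((hX.isHalfWaveResponse_sin hω hconv).isHalfWave_e hwp).harmonicCoeff_of_even hω hn

variable (hfreq : S.FreqDefined ω)
include hfreq

theorem one_add_Ll_ne_zero (hn : Odd n) : 1 + S.Ll (n * ω) ≠ 0 :=
  hconv.one_add_Ll_ne_zero hX.response (isResetCycle_resetInstants hω hX.trigger_ne_zero) hwp hω
    hfreq hn

variable (hdet : (S.Cr.Aρ * S.Cr.expHalf ω + 1).det ≠ 0) (hΔ : S.Δc ω 0 ≠ 0)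
include hdet hΔ

theorem jumpGain_mul_ΓDen : jumpGain ω X * S.ΓDen ω = 1 := by
  refine (hX.isHalfWaveResponse_sin hω hconv).jumpGain_mul_ΓDen hω hwp hfreq hX.trigger_ne_zero
    hdet hΔ (fun n hn => hX.one_add_Ll_ne_zero hω hconv hwp hfreq hn)
    (fun n _ _ => by simp [harmonicCoeff]) fun n _ hn1 => ?_
  simpa [hn1] using harmonicCoeff_const_mul_sin hω.ne' D one_ne_zero n

theorem harmonic_balance (hn : Odd n) :
    harmonicCoeff ω n X.e * (1 + S.Ll (n * ω)) =
      -(S.C4.freq (n * ω) * S.P.freq (n * ω) * (S.C3.freq (n * ω) * (S.Γ ω * S.Cρ ω n *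
        phaseMul n (S.C1.freq ω * harmonicCoeff ω 1 X.e)) + if n = 1 then (D : ℂ) else 0)) := by
  have h := hX.isHalfWaveResponse_sin hω hconv
  have hgain : jumpGain ω X = S.Γ ω :=
    eq_one_div_of_mul_eq_one_left (hX.jumpGain_mul_ΓDen hω hconv hwp hfreq hdet hΔ)
  have hz := h.harmonicCoeff_z hwp hω odd_one (hfreq 1 odd_one S.C1 (by simp))
  have hd := harmonicCoeff_const_mul_sin hω.ne' D one_ne_zero n
  simp only [Nat.cast_one, one_mul] at hz hd
  have hr : harmonicCoeff ω n (fun _ => 0) = 0 := by simp [harmonicCoeff]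
  rw [h.harmonic_balance hω hwp hfreq hX.trigger_ne_zero hdet hΔ hn, hr, zero_sub, hd, hz, hgain]

theorem PS_one_mul (hD : D ≠ 0) :
    PS ω D X 1 * (1 + S.Lo ω) = -(S.P.freq ω * S.C4.freq ω) := by
  have hDc : (D : ℂ) ≠ 0 := ofReal_ne_zero.2 hD
  have hbal := hX.harmonic_balance hω hconv hwp hfreq hdet hΔ odd_one
  simp only [phaseMul_one, if_true, Nat.cast_one, one_mul] at hbal
  rw [PS_eq_div hω.ne' D X one_ne_zero, Lo_eq, Lρ, Nat.cast_one, one_mul]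
  field_simp
  linear_combination hbal

theorem one_add_Lo_ne_zero (hD : D ≠ 0) : 1 + S.Lo ω ≠ 0 := by
  intro hLo
  have hPC := hX.PS_one_mul hω hconv hwp hfreq hdet hΔ hD
  rw [hLo, mul_zero, eq_comm, neg_eq_zero] at hPC
  have hzero : S.Lo ω = 0 := by
    simp only [Lo_eq, Ll, Lρ, Nat.cast_one, one_mul]
    linear_combination ((S.Cr.base.freq ω + S.C2.freq ω) * S.C3.freq ω * S.C1.freq ω +
      S.Γ ω * S.Cρ ω 1 * S.C3.freq ω * S.C1.freq ω) * hPC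
  simp [hzero] at hLo

theorem PS_of_odd (hD : 0 < D) (hn : Odd n) (hn1 : n ≠ 1) :
    PS ω D X n =
      -S.Sl (n * ω) * phaseMul n (PS ω D X 1) * S.Γ ω * S.L ω n * S.C4.freq (n * ω) := by
  have hDc : (D : ℂ) ≠ 0 := ofReal_ne_zero.2 hD.ne'
  have hE : harmonicCoeff ω 1 X.e = PS ω D X 1 * D := by
    rw [PS_eq_div hω.ne' D X one_ne_zero, div_mul_cancel₀ _ hDc]
  have hLn := hX.one_add_Ll_ne_zero hω hconv hwp hfreq hn
  have hbal := hX.harmonic_balance hω hconv hwp hfreq hdet hΔ hn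
  rw [if_neg hn1, hE, phaseMul_mul, phaseMul_mul, phaseMul_ofReal n hD.le,
    phaseMul_eq_mul_exp n (S.C1.freq ω)] at hbal
  rw [PS_eq_div hω.ne' D X hn.pos.ne', L, if_neg hn1, if_pos hn, Sl]
  field_simp
  linear_combination hbal

end IsTwoResetSteadyState

end ResetLoop

end ProcessSensitivity

end

theorem corollary1 (S : ResetLoop) (ω D : ℝ) (hω : 0 < ω) (hD : 0 < D)
    -- the functions in the formulas are defined
    (hfreq : S.FreqDefined ω) (hwp : S.WellPosed)
    (hdet : (S.Cr.Aρ * S.Cr.expHalf ω + 1).det ≠ 0) (hΔ : S.Δcn ω 1 ≠ 0)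
    -- the two-reset steady-state response to the disturbance
    (X : S.Trajectory)
    (hX : S.IsTwoResetSteadyState ω (fun _ => 0) (fun t => D * Real.sin (ω * t)) X)
    (hconv : S.IsConvergent (ResetLoop.resetInstants ω X) (fun _ => 0)
      (fun t => D * Real.sin (ω * t))) :
    -- no division by zero and no divergent series in the formulas
    ((∀ n : ℕ, Odd n → 1 < n → 1 + S.Ll (n * ω) ≠ 0) ∧ Summable (S.ΓTerm ω) ∧ S.ΓDen ω ≠ 0 ∧
      1 + S.Lo ω ≠ 0) ∧
    -- first harmonic
    ResetLoop.PS ω D X 1 = -(S.P.freq ω * S.C4.freq ω) / (1 + S.Lo ω) ∧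
    -- odd harmonics of higher order
    (∀ n : ℕ, Odd n → 1 < n →
      ResetLoop.PS ω D X n =
        -S.Sl (n * ω) *
          (‖ResetLoop.PS ω D X 1‖ * Complex.exp (Complex.I * n * Complex.arg (ResetLoop.PS ω D X 1)))
          * S.Γ ω * S.L ω n * S.C4.freq (n * ω)) ∧
    -- even harmonics
    (∀ n : ℕ, Even n → 2 ≤ n → ResetLoop.PS ω D X n = 0) := by
  have hΔc : S.Δc ω 0 ≠ 0 := by rwa [ResetLoop.Δcn, if_pos rfl] at hΔ
  have hΓ : S.ΓDen ω ≠ 0 :=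
    right_ne_zero_of_mul_eq_one (hX.jumpGain_mul_ΓDen hω hconv hwp hfreq hdet hΔc)
  have hLo : 1 + S.Lo ω ≠ 0 := hX.one_add_Lo_ne_zero hω hconv hwp hfreq hdet hΔc hD.ne'
  refine ⟨⟨fun n hn _ => hX.one_add_Ll_ne_zero hω hconv hwp hfreq hn, S.summable_ΓTerm hwp hω,
    hΓ, hLo⟩, ?_, fun n hn hn1 => ?_, fun n hn _ => ?_⟩
  · exact eq_div_of_mul_eq hLo (hX.PS_one_mul hω hconv hwp hfreq hdet hΔc hD.ne')
  · exact hX.PS_of_odd hω hconv hwp hfreq hdet hΔc hD hn hn1.ne'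
  · rw [ResetLoop.PS, hX.harmonicCoeff_e_of_even hω hconv hwp hn, zero_div]
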